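/- Let $G$ be a locally compact Hausdorff group with a fixed left Haar measure $dt$, and let $L^1(G)$ be its complex group algebra with convolution $(f*g)(t)=\int_G f(s)g(s^{-1}t)\,ds$. Put $L^1_0(G)=\{f\in L^1(G):\int_G f(t)\,dt=0\}$, let $\tilde L^1(G)=L^1(G)\oplus\mathbb C$ be the unitalization of $L^1(G)$ (with norm $\|f\|_1+|\lambda|$), and put $\tilde L^1_0(G)=\{(f,\lambda)\in\tilde L^1(G):\lambda=-\int_G f(t)\,dt\}$. These are Banach algebras. A Banach algebra $B$ is said to have property $(CB)$ if, for every complex Banach space $E$ and every continuous anti-representation $\Phi:B\to\mathcal L(E)$ (that is, $\Phi$ is linear, norm-continuous and $\Phi(ab)=\Phi(b)\Phi(a)$), each continuous left $B$-module map $\Xi:B\to E^*$ is of the form $\Xi(a)=\varphi_0\circ\Phi(a)$ $(a\in B)$ for some $\varphi_0\in E^*$. Here $E^*$ is a left $B$-module through $(a\cdot\varphi)(x)=\varphi(\Phi(a)x)$. Equivalently, the first left Hochschild cohomology of $B$ with coefficients in every such dual module $E^*$ vanishes. A bounded norm-continuous anti-representation of $G$ on a Banach space $E$ is a map $\mu:G\to\mathcal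 L(E)$ with $\mu_e=\mathrm{id}$, $\mu_{st}=\mu_t\mu_s$ and $\sup_{t\in G}\|\mu_t\|<\infty$ such that $t\mapsto\mu_t(x)$ is norm-continuous for each $x\in E$. For $a\in L^1(G)$ and $x\in E$, put $\hat\mu(a)x=\int_G a(t)\mu_t(x)\,dt$ (Bochner integral). The following statements are equivalent. 1. $G$ is amenable, that is, there is a left invariant mean on $L^\infty(G)$. 2. The Banach algebra $\tilde L^1_0(G)$ has property $(CB)$. 3. The Banach algebra $L^1_0(G)$ has property $(CB)$. 4. For any bounded norm-continuous anti-representation $\mu$ of $G$ on a complex Banach space $E$ and any norm-continuous $L^1_0(G)$-module map $\Xi:L^1_0(G)\to E^*$ (that is, $\Xi$ is linear and $\Xi(a*b)(x)=\Xi(b)(\hat\mu(a)x)$ for $a,b\in L^1_0(G)$ and $x\in E$), there exists $f\in E^*$ such that $\Xi(a)(x)=f(\hat\mu(a)x)$ for all $a\in L^1_0(G)$ and $x\in E$. -/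

import Mathlib

open MeasureTheory Filter Topology
open scoped ENNReal

universe u v

set_option linter.unusedSectionVars false

noncomputable section

namespace GroupAlgebra

section Convolution

variable {G : Type*} [Group G] [TopologicalSpace G] [IsTopologicalGroup G]
  [LocallyCompactSpace G] [MeasurableSpace G] [BorelSpace G]
  {μ : Measure G} [μ.IsHaarMeasure] [μ.Regular]
  {X : Type*} [NormedAddCommGroup X] [NormedSpace ℂ X]

/-- A continuous function on `G` is strongly measurable on every set of finite measure. -/
theorem aestronglyMeasurable_restrict {F : G → X} (hF : Continuous F) {s : Set G}
    (hs : MeasurableSet s) (h : μ s ≠ ∞) : AEStronglyMeasurable F (μ.restrict s) := by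
  have key : ∀ n : ℕ, ∃ K ⊆ s, IsCompact K ∧ IsClosed K ∧ μ (s \ K) < ((n : ℝ≥0∞) + 1)⁻¹ :=
    fun n => hs.exists_isCompact_isClosed_sdiff_lt h (ENNReal.inv_ne_zero.2 (by finiteness))
  choose K hKs hKc hKcl hKm using key
  have hae : s =ᵐ[μ] (⋃ n, K n : Set G) := by
    refine (Filter.EventuallyLE.antisymm ?_ (Set.iUnion_subset hKs).eventuallyLE)
    rw [ae_le_set]
    refine le_antisymm ?_ zero_le
    have ht : Tendsto (fun n : ℕ => ((n : ℝ≥0∞) + 1)⁻¹) atTop (𝓝 0) := by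
      have h := (tendsto_add_atTop_iff_nat 1).2 ENNReal.tendsto_inv_nat_nhds_zero
      simpa using h
    exact ge_of_tendsto' ht fun n =>
      (measure_mono (Set.sdiff_subset_sdiff_right (Set.subset_iUnion K n))).trans (hKm n).le
  rw [Measure.restrict_congr_set hae, aestronglyMeasurable_iUnion_iff]
  exact fun n => hF.continuousOn.aestronglyMeasurable_of_isCompact (hKc n) (hKcl n).measurableSet

/-- If `f ∈ L¹(G)` and `F : G → X` is continuous and bounded, then `f • F` is Bochner integrable. -/
theorem integrable_smul (f : Lp ℂ 1 μ) {F : G → X} (hF : Continuous F)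
    {C : ℝ} (hC : ∀ t, ‖F t‖ ≤ C) : Integrable (fun t => f t • F t) μ := by
  have hm : AEStronglyMeasurable (fun t => f t • F t) μ := by
    let S : ℕ → Set G := fun n => {t | 1 / ((n : ℝ) + 1) ≤ ‖f t‖}
    have hS : ∀ n, MeasurableSet (S n) := fun n =>
      measurableSet_le measurable_const (Lp.stronglyMeasurable f).measurable.norm
    have hfin : ∀ n, μ (S n) ≠ ∞ := fun n =>
      ((L1.integrable_coeFn f).measure_norm_ge_lt_top (by positivity)).ne
    have hind : (fun t => f t • F t) = (⋃ n, S n).indicator fun t => f t • F t := by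
      symm
      rw [Set.indicator_eq_self]
      intro t ht
      have h0 : 0 < ‖f t‖ := by
        rw [norm_pos_iff]
        intro h
        exact ht (by simp [h])
      obtain ⟨n, hn⟩ := exists_nat_one_div_lt h0
      exact Set.mem_iUnion.2 ⟨n, hn.le⟩
    rw [hind, aestronglyMeasurable_indicator_iff (MeasurableSet.iUnion hS),
      aestronglyMeasurable_iUnion_iff]
    exact fun n => (Lp.stronglyMeasurable f).aestronglyMeasurable.smul
      (aestronglyMeasurable_restrict hF (hS n) (hfin n))
  refine Integrable.mono' ((L1.integrable_coeFn f).norm.mul_const C) hm ?_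
  filter_upwards with t
  rw [norm_smul]
  exact mul_le_mul_of_nonneg_left (hC t) (norm_nonneg _)

/-- Left translation on `Lᵖ(G)`: `(λ_s f)(t) = f (s⁻¹ t)` for almost every `t`. -/
def leftTranslate {p : ℝ≥0∞} (s : G) (f : Lp ℂ p μ) : Lp ℂ p μ :=
  Lp.compMeasurePreserving (fun t => s⁻¹ * t) (measurePreserving_mul_left μ s⁻¹) f

theorem norm_leftTranslate (s : G) (f : Lp ℂ 1 μ) : ‖leftTranslate s f‖ = ‖f‖ :=
  Lp.norm_compMeasurePreserving _ _

theorem continuous_leftTranslate (f : Lp ℂ 1 μ) : Continuous fun s : G => leftTranslate s f := by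
  have : Fact ((1 : ℝ≥0∞) ≠ ∞) := ⟨ENNReal.one_ne_top⟩
  have h : Continuous fun s : G => (DomMulAct.mk s⁻¹) • f :=
    (DomMulAct.continuous_mk.comp continuous_inv).smul continuous_const
  exact h

/-- For `F : G → X` continuous and bounded, the bounded operator `f ↦ ∫ f(t) F(t) dt` on
`L¹(G)`. -/
def integrateAgainst {F : G → X} (hF : Continuous F) {C : ℝ} (hC : ∀ t, ‖F t‖ ≤ C) :
    Lp ℂ 1 μ →L[ℂ] X :=
  LinearMap.mkContinuous
    { toFun := fun f => ∫ t, f t • F t ∂μ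
      map_add' := fun f g => by
        rw [← integral_add (integrable_smul f hF hC) (integrable_smul g hF hC)]
        refine integral_congr_ae ?_
        filter_upwards [Lp.coeFn_add f g] with t h
        rw [h, Pi.add_apply, add_smul]
      map_smul' := fun c f => by
        rw [RingHom.id_apply, ← integral_smul]
        refine integral_congr_ae ?_
        filter_upwards [Lp.coeFn_smul c f] with t h
        rw [h, Pi.smul_apply, smul_eq_mul, mul_smul] }
    C (fun f => by
      show ‖∫ t, f t • F t ∂μ‖ ≤ C * ‖f‖
      rw [L1.norm_eq_integral_norm, mul_comm, ← integral_mul_const]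
      refine norm_integral_le_of_norm_le ((L1.integrable_coeFn f).norm.mul_const C) ?_
      filter_upwards with t
      rw [norm_smul]
      exact mul_le_mul_of_nonneg_left (hC t) (norm_nonneg _))

theorem integrateAgainst_apply {F : G → X} (hF : Continuous F) {C : ℝ} (hC : ∀ t, ‖F t‖ ≤ C)
    (f : Lp ℂ 1 μ) : integrateAgainst hF hC f = ∫ t, f t • F t ∂μ := rfl

/-- Convolution on `L¹(G)`: `(f ∗ g)(t) = ∫ f(s) g(s⁻¹ t) ds`, that is,
`f ∗ g = ∫ f(s) λ_s(g) ds` as a Bochner integral in `L¹(G)`. (By `integral_convolve_smul` below,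
`∫ (f ∗ g) F = ∫∫ f(s) g(t) F(st) dt ds` for all bounded continuous `F`.) -/
def convolve (f g : Lp ℂ 1 μ) : Lp ℂ 1 μ := ∫ s, f s • leftTranslate s g ∂μ

theorem convolve_eq (f g : Lp ℂ 1 μ) :
    convolve f g = integrateAgainst (μ := μ) (continuous_leftTranslate g)
      (fun s => (norm_leftTranslate s g).le) f := rfl

theorem integral_translate_smul (s : G) (g : Lp ℂ 1 μ) (F : G → X) :
    ∫ t, leftTranslate s g t • F t ∂μ = ∫ t, g t • F (s * t) ∂μ := by
  rw [← integral_mul_left_eq_self (fun t => leftTranslate s g t • F t) s]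
  refine integral_congr_ae ?_
  have h := Lp.coeFn_compMeasurePreserving g (measurePreserving_mul_left μ s⁻¹)
  have h' := (measurePreserving_mul_left μ s).quasiMeasurePreserving.ae h
  filter_upwards [h'] with t ht
  have e : leftTranslate s g (s * t) = g t := by
    refine Eq.trans ht ?_
    simp
  simp only [e]

/-- Integration against `F` turns convolution into iterated integration. -/
theorem integral_convolve_smul [CompleteSpace X] (f g : Lp ℂ 1 μ) {F : G → X} (hF : Continuous F)
    {C : ℝ} (hC : ∀ t, ‖F t‖ ≤ C) :
    ∫ t, convolve f g t • F t ∂μ = ∫ s, f s • ∫ t, g t • F (s * t) ∂μ ∂μ := by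
  rw [← integrateAgainst_apply hF hC, convolve, ← ContinuousLinearMap.integral_comp_comm _
    (integrable_smul f (continuous_leftTranslate g) (fun s => (norm_leftTranslate s g).le))]
  simp only [map_smul, integrateAgainst_apply, integral_translate_smul]

theorem leftTranslate_add (s : G) (f g : Lp ℂ 1 μ) :
    leftTranslate s (f + g) = leftTranslate s f + leftTranslate s g :=
  map_add (Lp.compMeasurePreserving _ (measurePreserving_mul_left μ s⁻¹)) f g

theorem leftTranslate_smul (s : G) (c : ℂ) (f : Lp ℂ 1 μ) :
    leftTranslate s (c • f) = c • leftTranslate s f :=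
  map_smul (Lp.compMeasurePreservingₗ ℂ _ (measurePreserving_mul_left μ s⁻¹)) c f

theorem leftTranslate_mul (s t : G) (f : Lp ℂ 1 μ) :
    leftTranslate (s * t) f = leftTranslate s (leftTranslate t f) := by
  unfold leftTranslate
  rw [← Lp.compMeasurePreserving_comp_apply]
  congr 2
  funext x
  simp [mul_assoc]

/-- `λ_s` as a bounded operator on `L¹(G)`. -/
def leftTranslateL (s : G) : Lp ℂ 1 μ →L[ℂ] Lp ℂ 1 μ :=
  (Lp.compMeasurePreservingₗᵢ ℂ _ (measurePreserving_mul_left μ s⁻¹)).toContinuousLinearMap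

theorem leftTranslateL_apply (s : G) (f : Lp ℂ 1 μ) : leftTranslateL s f = leftTranslate s f := rfl

theorem convolve_assoc (f g h : Lp ℂ 1 μ) :
    convolve (convolve f g) h = convolve f (convolve g h) := by
  refine (integral_convolve_smul f g (continuous_leftTranslate h)
    (fun s => (norm_leftTranslate s h).le)).trans ?_
  show _ = ∫ s, f s • leftTranslate s (convolve g h) ∂μ
  refine integral_congr_ae (ae_of_all _ fun s => ?_)
  show f s • ∫ t, g t • leftTranslate (s * t) h ∂μ = f s • leftTranslate s (convolve g h)
  rw [← leftTranslateL_apply, convolve, ← ContinuousLinearMap.integral_comp_comm _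
    (integrable_smul g (continuous_leftTranslate h) (fun s => (norm_leftTranslate s h).le))]
  simp only [map_smul, leftTranslateL_apply, leftTranslate_mul]

theorem convolve_add (f g h : Lp ℂ 1 μ) :
    convolve f (g + h) = convolve f g + convolve f h := by
  unfold convolve
  rw [← integral_add
    (integrable_smul f (continuous_leftTranslate g) (fun s => (norm_leftTranslate s g).le))
    (integrable_smul f (continuous_leftTranslate h) (fun s => (norm_leftTranslate s h).le))]
  simp only [leftTranslate_add, smul_add]

theorem convolve_smul (c : ℂ) (f g : Lp ℂ 1 μ) : convolve f (c • g) = c • convolve f g := by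
  unfold convolve
  rw [← integral_smul]
  simp only [leftTranslate_smul, smul_comm c]

theorem add_convolve (f g h : Lp ℂ 1 μ) :
    convolve (f + g) h = convolve f h + convolve g h := by
  simp only [convolve_eq, map_add]

theorem smul_convolve (c : ℂ) (f g : Lp ℂ 1 μ) : convolve (c • f) g = c • convolve f g := by
  simp only [convolve_eq, map_smul]

theorem norm_convolve_le (f g : Lp ℂ 1 μ) : ‖convolve f g‖ ≤ ‖f‖ * ‖g‖ := by
  rw [L1.norm_eq_integral_norm f, ← integral_mul_const]
  refine norm_integral_le_of_norm_le ((L1.integrable_coeFn f).norm.mul_const _) ?_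
  filter_upwards with t
  rw [norm_smul, norm_leftTranslate]

/-- `L¹(G)` is a Banach algebra under convolution. -/
instance instNonUnitalNormedRing : NonUnitalNormedRing (Lp ℂ 1 μ) :=
  { (inferInstance : NormedAddCommGroup (Lp ℂ 1 μ)) with
    mul := convolve
    left_distrib := convolve_add
    right_distrib := add_convolve
    zero_mul := fun f => by
      have h := smul_convolve (0 : ℂ) f f
      rwa [zero_smul, zero_smul] at h
    mul_zero := fun f => by
      have h := convolve_smul (0 : ℂ) f f
      rwa [zero_smul, zero_smul] at h
    mul_assoc := convolve_assoc
    norm_mul_le := norm_convolve_le }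

theorem mul_def (f g : Lp ℂ 1 μ) : f * g = ∫ s, f s • leftTranslate s g ∂μ := rfl

instance instIsScalarTower : IsScalarTower ℂ (Lp ℂ 1 μ) (Lp ℂ 1 μ) := ⟨smul_convolve⟩

instance instSMulCommClass : SMulCommClass ℂ (Lp ℂ 1 μ) (Lp ℂ 1 μ) :=
  ⟨fun c f g => (convolve_smul c f g).symm⟩

theorem integral_mul_eq (f g : Lp ℂ 1 μ) :
    ∫ t, (f * g) t ∂μ = (∫ t, f t ∂μ) * ∫ t, g t ∂μ := by
  have h := integral_convolve_smul f g (F := fun _ => (1 : ℂ)) continuous_const (C := 1) (by simp)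
  simp only [smul_eq_mul, mul_one, integral_mul_const] at h
  exact h

theorem integral_add_eq (f g : Lp ℂ 1 μ) :
    ∫ t, (f + g) t ∂μ = (∫ t, f t ∂μ) + ∫ t, g t ∂μ := by
  rw [integral_congr_ae (Lp.coeFn_add f g)]
  exact integral_add (L1.integrable_coeFn f) (L1.integrable_coeFn g)

theorem integral_smul_eq (c : ℂ) (f : Lp ℂ 1 μ) : ∫ t, (c • f) t ∂μ = c * ∫ t, f t ∂μ := by
  rw [integral_congr_ae (Lp.coeFn_smul c f)]
  exact integral_const_mul c _

theorem integral_zero_eq : ∫ t, (0 : Lp ℂ 1 μ) t ∂μ = 0 := by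
  rw [integral_congr_ae (Lp.coeFn_zero ℂ 1 μ)]
  simp

variable (μ)

/-- `L¹₀(G) = {f ∈ L¹(G) : ∫ f = 0}`, with the norm, topology and product of `L¹(G)`. -/
def L10 : NonUnitalSubalgebra ℂ (Lp ℂ 1 μ) where
  carrier := {f | ∫ t, f t ∂μ = 0}
  zero_mem' := integral_zero_eq
  add_mem' := fun {f g} hf hg => by
    have h := integral_add_eq f g
    rw [show ∫ t, f t ∂μ = 0 from hf, show ∫ t, g t ∂μ = 0 from hg, add_zero] at h
    exact h
  mul_mem' := fun {f g} hf _ => by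
    have h := integral_mul_eq f g
    rw [show ∫ t, f t ∂μ = 0 from hf, zero_mul] at h
    exact h
  smul_mem' := fun c f hf => by
    have h := integral_smul_eq c f
    rw [show ∫ t, f t ∂μ = 0 from hf, mul_zero] at h
    exact h

/-- The unitalization `L¹(G) ⊕ ℂ`, a Banach algebra with norm `‖(f, c)‖ = ‖f‖ + |c|`. -/
abbrev UnitalL1 : Type _ := WithLp 1 (Unitization ℂ (Lp ℂ 1 μ))

/-- `{(f, c) ∈ L¹(G) ⊕ ℂ : c = -∫ f}`, with the norm, topology and product of the
unitalization. -/
def tildeL10 : NonUnitalSubalgebra ℂ (UnitalL1 μ) where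
  carrier := {a | a.ofLp.fst = -∫ t, a.ofLp.snd t ∂μ}
  zero_mem' := by
    show (0 : ℂ) = -∫ t, (0 : Lp ℂ 1 μ) t ∂μ
    rw [integral_zero_eq, neg_zero]
  add_mem' := fun {a b} ha hb => by
    show a.ofLp.fst + b.ofLp.fst = -∫ t, (a.ofLp.snd + b.ofLp.snd) t ∂μ
    rw [integral_add_eq, show a.ofLp.fst = _ from ha, show b.ofLp.fst = _ from hb]
    ring
  mul_mem' := fun {a b} ha hb => by
    show a.ofLp.fst * b.ofLp.fst = -∫ t, (a.ofLp.fst • b.ofLp.snd + b.ofLp.fst • a.ofLp.snd +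
      a.ofLp.snd * b.ofLp.snd) t ∂μ
    rw [integral_add_eq, integral_add_eq, integral_smul_eq, integral_smul_eq, integral_mul_eq,
      show a.ofLp.fst = _ from ha, show b.ofLp.fst = _ from hb]
    ring
  smul_mem' := fun c a ha => by
    show c * a.ofLp.fst = -∫ t, (c • a.ofLp.snd) t ∂μ
    rw [integral_smul_eq, show a.ofLp.fst = _ from ha]
    ring

/-- `G` is amenable: there is a left invariant mean on `L^∞(G)`, that is, a bounded linear
functional `M` with `‖M‖ = 1 = M(1)` and `M(λ_s φ) = M(φ)` for all `s` in `G`. -/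
def IsAmenable : Prop :=
  ∃ M : StrongDual ℂ (Lp ℂ ∞ μ), ‖M‖ = 1 ∧ M ((memLp_top_const (1 : ℂ)).toLp _) = 1 ∧
    ∀ (s : G) (φ : Lp ℂ ∞ μ), M (leftTranslate s φ) = M φ

end Convolution

section PropertyCB

/-- Property (CB) of a topological algebra `B`. Here `Φ` is a continuous anti-representation of `B`
on a Banach space `E`, so that `E*` is a left `B`-module by `(a • φ)(x) = φ(Φ(a) x)`, and
`Ξ : B → E*` is a continuous left module map; it has to be of the form `a ↦ a • φ₀`. -/
def HasPropertyCB (B : Type u) [NonUnitalRing B] [Module ℂ B] [TopologicalSpace B] : Prop :=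
  ∀ (E : Type v) [NormedAddCommGroup E] [NormedSpace ℂ E] [CompleteSpace E]
    (Φ : B →L[ℂ] (E →L[ℂ] E)) (Ξ : B →L[ℂ] StrongDual ℂ E),
    (∀ a b, Φ (a * b) = Φ b ∘L Φ a) →
    (∀ a b, Ξ (a * b) = Ξ b ∘L Φ a) →
    ∃ φ₀ : StrongDual ℂ E, ∀ a, Ξ a = φ₀ ∘L Φ a

end PropertyCB

section Integrated

variable {G : Type*} [Group G] [TopologicalSpace G] {E : Type*}
  [NormedAddCommGroup E] [NormedSpace ℂ E]

/-- A norm-continuous anti-representation of `G` on `E` (`t ↦ π_t x` is norm-continuous for every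
`x`) that is uniformly bounded. -/
structure IsBoundedAntiRep (π : G → (E →L[ℂ] E)) : Prop where
  map_one : π 1 = ContinuousLinearMap.id ℂ E
  map_mul : ∀ s t, π (s * t) = π t ∘L π s
  continuous_apply : ∀ x, Continuous fun t => π t x
  bounded : ∃ C : ℝ, ∀ t, ‖π t‖ ≤ C

/-- The integrated form `π̂(a) x = ∫ a(t) π_t(x) dt`. -/
def integratedForm [MeasurableSpace G] {μ : Measure G} (π : G → (E →L[ℂ] E)) (a : Lp ℂ 1 μ)
    (x : E) : E :=
  ∫ t, a t • π t x ∂μ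

end Integrated

end GroupAlgebra

end

noncomputable section

namespace GroupAlgebra

open Measure CompactlySupported Pointwise

/-! ### Right translation and the density of compactly supported functions in `L¹(G)`. -/

section RightTranslation

variable {G : Type*} [Group G] [TopologicalSpace G] [IsTopologicalGroup G]
  [LocallyCompactSpace G] [MeasurableSpace G] [BorelSpace G]
  {μ : Measure G} [μ.IsHaarMeasure] [μ.Regular]
  {X : Type*} [NormedAddCommGroup X] [NormedSpace ℂ X]

/-! Property (CB) of `B` is equivalent to the existence of `φ` in the bidual of `B` with `a φ = a`
for all `a` in `B` (`HasVirtualRightIdentity`). Such a `φ` represents a module map `Ξ` by `φ₀(x) =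
φ(b ↦ Ξ(b)(x))`; conversely, (CB) is applied to `E = B*` and the canonical embedding of `B` in its
bidual.

Both ideals consist of elements of total mass zero. If `G` is amenable, the bidual of `L¹(G)`
contains an `m` of mass 1 with `f m = (∫ f) m` for all `f`
(`IsAmenable.exists_topologically_invariant`). With `δ` the adjoined unit, `δ - m` has mass zero and
`a (δ - m) = a` whenever `a` has mass zero, so it is the right identity wanted for `tildeL10 μ`. For
`L10 μ`, `δ` is replaced by a weak-* cluster point of an approximate identity.

Conversely, let `φ` be a right identity for either ideal and let `∫ e = 1`. Then `m = e - e φ` has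
mass 1. As `d = λ_s e - e` has mass zero, `λ_s m - m = d - d φ = 0`. A left invariant functional on
`L¹(G)*` of mass 1 yields an invariant mean on `L^∞(G)` (`isAmenable_of_invariant`), through almost
invariant densities. Neither direction identifies `L^∞(G)` with `L¹(G)*`.

The last condition only concerns modules that come from representations of `G`, whereas the action
of `G` on the dual of `L10 μ` need not be norm-continuous. There `E` is the closed subspace
`contDual` of functionals with norm-continuous orbits. It contains every `F(f ·)` with `f` in
`L¹(G)`, which suffices to define `e φ`. -/

theorem continuous_integral_of_compact_support {f : G → G → ℝ}
    (hf : Continuous (Function.uncurry f))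
    (hs : ∀ V : Set G, IsCompact V → ∃ K : Set G, IsCompact K ∧ ∀ t ∈ V, ∀ s ∉ K, f t s = 0) :
    Continuous fun t => ∫ s, f t s ∂μ := by
  rw [continuous_iff_continuousAt]
  intro t
  obtain ⟨V, hV, hVt⟩ := exists_compact_mem_nhds t
  obtain ⟨K, hK, hKs⟩ := hs V hV
  exact (continuousOn_integral_of_compact_support hK hf.continuousOn
    fun p x hp hx => hKs p hp x hx).continuousAt hVt

theorem map_mul_right_eq_modularCharacterFun_smul (t : G) :
    μ.map (· * t) = modularCharacterFun t • μ := by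
  have : (μ.map (· * t)).Regular := Regular.map (Homeomorph.mulRight t)
  rw [modularCharacterFun_eq_haarScalarFactor μ]
  exact isMulLeftInvariant_eq_smul_of_regular _ μ

theorem integral_comp_mul_right {E : Type*} [NormedAddCommGroup E] [NormedSpace ℝ E]
    (t : G) (ψ : G → E) :
    ∫ s, ψ (s * t) ∂μ = (modularCharacterFun t : ℝ) • ∫ s, ψ s ∂μ := by
  have h : ∫ s, ψ s ∂(μ.map (· * t)) = ∫ s, ψ (s * t) ∂μ :=
    (Homeomorph.mulRight t).isClosedEmbedding.measurableEmbedding.integral_map ψ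
  rw [← h, map_mul_right_eq_modularCharacterFun_smul, integral_smul_nnreal_measure]
  rfl

theorem exists_compact_support_mul_right {a : G → ℂ} (ha : HasCompactSupport a) {V : Set G}
    (hV : IsCompact V) :
    ∃ K : Set G, IsCompact K ∧ ∀ t ∈ V, ∀ s ∉ K, a (s * t⁻¹) = 0 := by
  refine ⟨tsupport a * V, ha.isCompact.mul hV, fun t ht s hs => ?_⟩
  by_contra h
  exact hs ⟨s * t⁻¹, subset_tsupport a h, t, ht, by simp⟩

-- The modular function is a quotient `∫ ψ(s t) ds / ∫ ψ(s) ds` with `ψ` continuous of compact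
-- support, and the numerator depends continuously on `t`.
variable (G) in
theorem continuous_modularCharacterFun : Continuous fun t : G => (modularCharacterFun t : ℝ) := by
  borelize G
  obtain ⟨ψ, hc, h0, h1⟩ := exists_continuous_nonneg_pos (1 : G)
  have hpos : 0 < ∫ s, ψ s ∂(haar : Measure G) :=
    ψ.continuous.integral_pos_of_hasCompactSupport_nonneg_nonzero hc h0 h1
  have hcont : Continuous fun t : G => ∫ s, ψ (s * t) ∂(haar : Measure G) := by
    refine continuous_integral_of_compact_support (f := fun t s => ψ (s * t))
      (ψ.continuous.comp (continuous_snd.mul continuous_fst)) fun V hV => ?_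
    refine ⟨tsupport ψ * V⁻¹, hc.isCompact.mul hV.inv, fun t ht s hs => ?_⟩
    by_contra h
    exact hs ⟨s * t, subset_tsupport ψ h, t⁻¹, by simpa using ht, by simp⟩
  have he : (fun t : G => (modularCharacterFun t : ℝ)) =
      fun t => (∫ s, ψ (s * t) ∂(haar : Measure G)) / ∫ s, ψ s ∂(haar : Measure G) := by
    funext t
    rw [integral_comp_mul_right, smul_eq_mul, mul_div_cancel_right₀ _ hpos.ne']
  rw [he]
  exact hcont.div_const _

variable (μ) in
/-- The class in `L¹(G)` of a continuous function with compact support. -/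
def ccToL1 (a : C_c(G, ℂ)) : Lp ℂ 1 μ :=
  (a.continuous.memLp_of_hasCompactSupport a.hasCompactSupport).toLp a

theorem coeFn_ccToL1 (a : C_c(G, ℂ)) : ccToL1 μ a =ᵐ[μ] a := MemLp.coeFn_toLp _

theorem integral_ccToL1_smul (a : C_c(G, ℂ)) (F : G → X) :
    ∫ t, ccToL1 μ a t • F t ∂μ = ∫ t, a t • F t ∂μ := by
  refine integral_congr_ae ?_
  filter_upwards [coeFn_ccToL1 (μ := μ) a] with t h
  rw [h]

theorem integral_ccToL1 (a : C_c(G, ℂ)) : ∫ t, ccToL1 μ a t ∂μ = ∫ t, a t ∂μ :=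
  integral_congr_ae (coeFn_ccToL1 a)

theorem norm_ccToL1_sub (a b : C_c(G, ℂ)) :
    ‖ccToL1 μ a - ccToL1 μ b‖ = ∫ t, ‖a t - b t‖ ∂μ := by
  rw [L1.norm_eq_integral_norm]
  refine integral_congr_ae ?_
  filter_upwards [Lp.coeFn_sub (ccToL1 μ a) (ccToL1 μ b), coeFn_ccToL1 (μ := μ) a,
    coeFn_ccToL1 (μ := μ) b] with t h h1 h2
  rw [h, Pi.sub_apply, h1, h2]

theorem norm_ccToL1 (a : C_c(G, ℂ)) : ‖ccToL1 μ a‖ = ∫ t, ‖a t‖ ∂μ := by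
  rw [L1.norm_eq_integral_norm]
  refine integral_congr_ae ?_
  filter_upwards [coeFn_ccToL1 (μ := μ) a] with t h1
  rw [h1]

theorem exists_continuous_hasCompactSupport_eLpNorm_indicator_sub_le (c : ℂ) {t : Set G}
    (ht : MeasurableSet t) (htμ : μ t < ∞) {ε : ℝ≥0∞} (hε : ε ≠ 0) :
    ∃ g : G → ℂ, eLpNorm (g - t.indicator fun _ => c) 1 μ ≤ ε ∧
      Continuous g ∧ HasCompactSupport g := by
  -- The approximant differs from the indicator, by at most `‖c‖`, only on `t \ s` and `u \ s`,
  -- where `s` is compact in `t` and `u` is open around `s`; each of these sets has measure at most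
  -- `η`.
  obtain ⟨η, hη, hηε⟩ : ∃ η : ℝ≥0∞, η ≠ 0 ∧ ‖c‖ₑ * (η + η) ≤ ε := by
    rcases eq_or_ne ε ∞ with rfl | h
    · exact ⟨1, one_ne_zero, le_top⟩
    · refine ⟨ε / (2 * (‖c‖ₑ + 1)), ENNReal.div_ne_zero.2 ⟨hε, by finiteness⟩, ?_⟩
      have h2 : 2 * (‖c‖ₑ + 1) ≠ 0 := by simp
      calc ‖c‖ₑ * (ε / (2 * (‖c‖ₑ + 1)) + ε / (2 * (‖c‖ₑ + 1)))
          = (2 * ‖c‖ₑ) * (ε / (2 * (‖c‖ₑ + 1))) := by ring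
        _ ≤ (2 * (‖c‖ₑ + 1)) * (ε / (2 * (‖c‖ₑ + 1))) := by gcongr; exact le_self_add
        _ = ε := ENNReal.mul_div_cancel h2 (by finiteness)
  obtain ⟨s, hst, hsc, hscl, hsμ⟩ := ht.exists_isCompact_isClosed_sdiff_lt htμ.ne hη
  obtain ⟨u, hsu, hu, huμ⟩ := s.exists_isOpen_lt_of_lt (μ := μ) (μ s + η)
    (ENNReal.lt_add_right hsc.measure_ne_top hη)
  have huη : μ (u \ s) ≤ η := by
    rw [measure_sdiff hsu hscl.nullMeasurableSet hsc.measure_ne_top]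
    exact tsub_le_iff_left.2 huμ.le
  obtain ⟨g, hg1, hgc, hgu, hg01⟩ := exists_continuousMap_one_of_isCompact_subset_isOpen hsc hu hsu
  refine ⟨fun x => (g x : ℂ) * c, ?_,
    (Complex.continuous_ofReal.comp g.continuous).mul continuous_const, ?_⟩
  · rw [eLpNorm_one_eq_lintegral_enorm]
    refine (lintegral_mono (g := (u \ s).indicator (fun _ => ‖c‖ₑ) +
      (t \ s).indicator fun _ => ‖c‖ₑ) fun x => ?_).trans ?_
    · by_cases hxs : x ∈ s
      · have : g x = 1 := hg1 hxs
        simp [this, hst hxs, hxs]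
      · have hgn : ‖(g x : ℂ) * c‖ₑ ≤ ‖c‖ₑ := by
          rw [enorm_mul]
          refine mul_le_of_le_one_left zero_le ?_
          rw [← ofReal_norm, Complex.norm_real, Real.norm_of_nonneg (hg01 x).1]
          exact ENNReal.ofReal_le_one.2 (hg01 x).2
        have hg0 : x ∉ u → g x = 0 := fun hx =>
          image_eq_zero_of_notMem_tsupport fun h => hx (hgu h)
        by_cases hxu : x ∈ u
        · by_cases hxt : x ∈ t
          · simp only [Pi.sub_apply, Pi.add_apply, Set.indicator_of_mem hxt,
              Set.indicator_of_mem (show x ∈ u \ s from ⟨hxu, hxs⟩),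
              Set.indicator_of_mem (show x ∈ t \ s from ⟨hxt, hxs⟩)]
            exact enorm_sub_le.trans (add_le_add hgn le_rfl)
          · simpa [hxt, hxu, hxs] using hgn
        · by_cases hxt : x ∈ t
          · simp [hg0 hxu, hxt, hxu, hxs]
          · simp [hg0 hxu, hxt, hxu]
    · simp only [Pi.add_apply]
      rw [lintegral_add_left (measurable_const.indicator (hu.measurableSet.diff hscl.measurableSet)),
        lintegral_indicator_const (hu.measurableSet.diff hscl.measurableSet),
        lintegral_indicator_const (ht.diff hscl.measurableSet), ← mul_add]
      exact (mul_le_mul_right (add_le_add huη hsμ.le) _).trans hηε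
  · exact HasCompactSupport.mul_right
      (HasCompactSupport.comp_left (g := ((↑) : ℝ → ℂ)) hgc Complex.ofReal_zero)

theorem exists_continuous_hasCompactSupport_eLpNorm_sub_le {f : G → ℂ} (hf : MemLp f 1 μ)
    {ε : ℝ≥0∞} (hε : ε ≠ 0) :
    ∃ g : G → ℂ, eLpNorm (f - g) 1 μ ≤ ε ∧ Continuous g ∧ HasCompactSupport g :=
  hf.induction_dense ENNReal.one_ne_top (fun g => Continuous g ∧ HasCompactSupport g)
    (fun c _ ht htμ _ hε =>
      exists_continuous_hasCompactSupport_eLpNorm_indicator_sub_le c ht htμ hε)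
    (fun _ _ hf hg => ⟨hf.1.add hg.1, hf.2.add hg.2⟩)
    (fun _ hf => (hf.1.memLp_of_hasCompactSupport (p := 1) hf.2).aestronglyMeasurable) hε

variable (μ) in
theorem denseRange_ccToL1 : DenseRange (ccToL1 μ) := by
  intro f
  rw [Metric.mem_closure_range_iff]
  intro ε hε
  obtain ⟨g, hle, hg, hgc⟩ := exists_continuous_hasCompactSupport_eLpNorm_sub_le (Lp.memLp f)
    (ε := ENNReal.ofReal (ε / 2)) (by simpa using hε)
  refine ⟨⟨⟨g, hg⟩, hgc⟩, ?_⟩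
  rw [Lp.dist_def]
  have h : eLpNorm (⇑f - ⇑(ccToL1 μ ⟨⟨g, hg⟩, hgc⟩)) 1 μ ≤ ENNReal.ofReal (ε / 2) := by
    refine le_trans (le_of_eq (eLpNorm_congr_ae ?_)) hle
    filter_upwards [coeFn_ccToL1 (μ := μ) ⟨⟨g, hg⟩, hgc⟩] with t ht
    simp only [Pi.sub_apply, ht]
    rfl
  exact (ENNReal.toReal_le_of_le_ofReal (by positivity) h).trans_lt (by linarith)

/-- The right translate `s ↦ Δ(t) a(s t⁻¹)`, where `Δ` is the modular function. -/
def ccRight (a : C_c(G, ℂ)) (t : G) : C_c(G, ℂ) where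
  toFun s := ((modularCharacterFun t : ℝ) : ℂ) * a (s * t⁻¹)
  continuous_toFun := continuous_const.mul (a.continuous.comp (continuous_mul_const _))
  hasCompactSupport' :=
    (a.hasCompactSupport.comp_homeomorph (Homeomorph.mulRight t⁻¹)).mul_left

theorem ccRight_apply (a : C_c(G, ℂ)) (t s : G) :
    ccRight a t s = ((modularCharacterFun t : ℝ) : ℂ) * a (s * t⁻¹) := rfl

theorem ccRight_one (a : C_c(G, ℂ)) : ccRight a 1 = a := by
  ext s
  simp [ccRight_apply, modularCharacterFun_map_one]

theorem integral_ccRight_smul (a : C_c(G, ℂ)) (t : G) (F : G → X) :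
    ∫ s, ccRight a t s • F s ∂μ = ∫ s, a s • F (s * t) ∂μ := by
  have h := integral_comp_mul_right (μ := μ) t (fun s => a (s * t⁻¹) • F s)
  simp only [mul_inv_cancel_right] at h
  rw [h, ← integral_smul]
  simp only [ccRight_apply, mul_smul, Complex.coe_smul]

/-- Since `ccRight a t` is `a * δ_t`, this is associativity: `(a * δ_t) * g = a * (δ_t * g)`. -/
theorem ccRight_mul (a : C_c(G, ℂ)) (t : G) (g : Lp ℂ 1 μ) :
    ccToL1 μ (ccRight a t) * g = ccToL1 μ a * leftTranslate t g := by
  refine (integral_ccToL1_smul _ _).trans ((integral_ccRight_smul a t _).trans ?_)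
  simp only [leftTranslate_mul]
  exact (integral_ccToL1_smul _ _).symm

theorem norm_ccRight (a : C_c(G, ℂ)) (t : G) : ‖ccToL1 μ (ccRight a t)‖ = ‖ccToL1 μ a‖ := by
  have h := integral_comp_mul_right (μ := μ) t (fun s => ‖a (s * t⁻¹)‖)
  simp only [mul_inv_cancel_right] at h
  rw [norm_ccToL1, norm_ccToL1, h, ← integral_smul]
  simp [ccRight_apply]

variable (μ) in
theorem continuous_ccRight (a : C_c(G, ℂ)) : Continuous fun t => ccToL1 μ (ccRight a t) := by
  rw [continuous_iff_continuousAt]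
  intro t₀
  rw [ContinuousAt, tendsto_iff_norm_sub_tendsto_zero]
  simp only [norm_ccToL1_sub]
  have hΔ := continuous_modularCharacterFun G
  have hc : Continuous fun t => ∫ s, ‖ccRight a t s - ccRight a t₀ s‖ ∂μ := by
    refine continuous_integral_of_compact_support
      (f := fun t s => ‖ccRight a t s - ccRight a t₀ s‖) ?_ fun V hV => ?_
    · refine Continuous.norm (Continuous.sub ?_ ((ccRight a t₀).continuous.comp continuous_snd))
      exact (Complex.continuous_ofReal.comp (hΔ.comp continuous_fst)).mul
        (a.continuous.comp (continuous_snd.mul continuous_fst.inv))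
    · obtain ⟨K, hK, h⟩ := exists_compact_support_mul_right a.hasCompactSupport
        (hV.union (isCompact_singleton (x := t₀)))
      refine ⟨K, hK, fun t ht s hs => ?_⟩
      rw [ccRight_apply, ccRight_apply, h t (Or.inl ht) s hs, h t₀ (Or.inr rfl) s hs]
      simp
  simpa using hc.tendsto t₀

/-- If `k` in `C_c(G)` is close to `h`, the test function `conj k / (|k| + δ)` is continuous,
bounded by 1, and pairs with `k` to nearly `‖k‖`, because `|k|² / (|k| + δ) ≥ |k| - δ`. It pairs
with `h` to zero, so `‖k‖` is small. -/
theorem eq_zero_of_forall_integral_smul_eq_zero {h : Lp ℂ 1 μ}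
    (H : ∀ F : G → ℂ, Continuous F → (∀ t, ‖F t‖ ≤ 1) → ∫ t, h t • F t ∂μ = 0) : h = 0 := by
  rw [← norm_le_zero_iff]
  refine le_of_forall_pos_le_add fun ε hε => ?_
  obtain ⟨k, hk⟩ := Metric.denseRange_iff.1 (denseRange_ccToL1 μ) h (ε / 3) (by positivity)
  have hK := k.hasCompactSupport.isCompact
  set δ : ℝ := ε / 3 / (μ.real (tsupport k) + 1) with hδdef
  have hm : 0 ≤ μ.real (tsupport k) := measureReal_nonneg
  have hδ : 0 < δ := by positivity
  have hδm : δ * μ.real (tsupport k) ≤ ε / 3 := by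
    rw [hδdef, div_mul_eq_mul_div, div_le_iff₀ (by positivity)]
    nlinarith
  let F : G → ℂ := fun t => (starRingEnd ℂ) (k t) / ((‖k t‖ + δ : ℝ) : ℂ)
  have hden : ∀ t, 0 < ‖k t‖ + δ := fun t => by positivity
  have hF : Continuous F := by
    refine (Complex.continuous_conj.comp k.continuous).div
      (Complex.continuous_ofReal.comp (k.continuous.norm.add continuous_const)) fun t => ?_
    exact_mod_cast (hden t).ne'
  have hF1 : ∀ t, ‖F t‖ ≤ 1 := fun t => by
    rw [norm_div, RCLike.norm_conj, Complex.norm_real, Real.norm_of_nonneg (hden t).le,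
      div_le_one (hden t)]
    linarith
  have hle : ‖ccToL1 μ k‖ - δ * μ.real (tsupport k) ≤ ‖∫ t, ccToL1 μ k t • F t ∂μ‖ := by
    have e1 : ∫ t, ccToL1 μ k t • F t ∂μ = ((∫ t, ‖k t‖ ^ 2 / (‖k t‖ + δ) ∂μ : ℝ) : ℂ) := by
      rw [integral_ccToL1_smul, ← integral_complex_ofReal]
      refine integral_congr_ae (ae_of_all _ fun t => ?_)
      simp only [F, smul_eq_mul]
      rw [← mul_div_assoc, Complex.mul_conj, Complex.normSq_eq_norm_sq]
      push_cast
      rfl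
    rw [e1, Complex.norm_real]
    refine le_trans ?_ (le_abs_self _)
    have hi : Integrable (fun t => ‖k t‖) μ :=
      k.continuous.norm.integrable_of_hasCompactSupport k.hasCompactSupport.norm
    have hi2 : Integrable ((tsupport k).indicator fun _ => δ) μ :=
      (integrable_indicator_iff (isClosed_tsupport _).measurableSet).2
        (integrableOn_const hK.measure_ne_top)
    have e2 : δ * μ.real (tsupport k) = ∫ t, (tsupport k).indicator (fun _ => δ) t ∂μ := by
      rw [integral_indicator (isClosed_tsupport _).measurableSet, setIntegral_const, smul_eq_mul,
        mul_comm]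
    rw [norm_ccToL1, e2, ← integral_sub hi hi2]
    refine integral_mono (hi.sub hi2) ?_ fun t => ?_
    · refine hi.mono' (Continuous.integrable_of_hasCompactSupport ?_ ?_).aestronglyMeasurable ?_
      · exact Continuous.div (k.continuous.norm.pow 2) (k.continuous.norm.add continuous_const)
          fun t => (hden t).ne'
      · refine k.hasCompactSupport.mono fun t ht => ?_
        contrapose! ht
        simp [Function.notMem_support.1 ht]
      · filter_upwards with t
        rw [Real.norm_of_nonneg (by positivity), div_le_iff₀ (hden t)]
        nlinarith [norm_nonneg (k t)]
    · by_cases ht : t ∈ tsupport k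
      · simp only [Set.indicator_of_mem ht]
        rw [le_div_iff₀ (hden t)]
        nlinarith
      · simp only [Set.indicator_of_notMem ht]
        rw [image_eq_zero_of_notMem_tsupport ht]
        simp
  have hle2 : ‖∫ t, ccToL1 μ k t • F t ∂μ‖ ≤ ‖ccToL1 μ k - h‖ := by
    have := (integrateAgainst (μ := μ) hF hF1).map_sub (ccToL1 μ k) h
    simp only [integrateAgainst_apply] at this
    rw [H F hF hF1, sub_zero] at this
    rw [← this, L1.norm_eq_integral_norm]
    refine norm_integral_le_of_norm_le (L1.integrable_coeFn _).norm ?_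
    filter_upwards with t
    rw [norm_smul]
    exact mul_le_of_le_one_right (norm_nonneg _) (hF1 t)
  rw [dist_eq_norm] at hk
  have h1 := norm_sub_rev h (ccToL1 μ k)
  have h2 := norm_le_norm_add_norm_sub (ccToL1 μ k) h
  linarith

/-- Mirror image of the definition of convolution: `a * b = ∫ b(t) (a * δ_t) dt`. By density `b` may
be taken in `C_c(G)`; both sides are then tested against bounded continuous functions, and compact
supports allow the exchange of integrals without σ-finiteness. -/
theorem ccToL1_mul_eq_integral (a : C_c(G, ℂ)) (b : Lp ℂ 1 μ) :
    ccToL1 μ a * b = ∫ t, b t • ccToL1 μ (ccRight a t) ∂μ := by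
  have hR := continuous_ccRight μ a
  have hRb : ∀ t, ‖ccToL1 μ (ccRight a t)‖ ≤ ‖ccToL1 μ a‖ := fun t => (norm_ccRight a t).le
  suffices h : (fun b => ccToL1 μ a * b) = fun b => integrateAgainst hR hRb b from congrFun h b
  refine (denseRange_ccToL1 μ).equalizer (continuous_const.mul continuous_id)
    (integrateAgainst hR hRb).continuous (funext fun b => ?_)
  simp only [Function.comp_apply]
  rw [← sub_eq_zero]
  refine eq_zero_of_forall_integral_smul_eq_zero fun F hF hF1 => ?_
  rw [← integrateAgainst_apply hF hF1, map_sub, sub_eq_zero]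
  simp only [integrateAgainst_apply]
  refine (integral_convolve_smul _ _ hF hF1).trans ?_
  have e := (integrateAgainst (μ := μ) hF hF1).integral_comp_comm
    (integrable_smul (ccToL1 μ b) hR hRb)
  simp only [map_smul, integrateAgainst_apply] at e
  refine Eq.trans ?_ e
  simp only [integral_ccToL1_smul, integral_ccRight_smul]
  simp only [← integral_smul]
  rw [integral_integral_swap_of_hasCompactSupport]
  · simp only [smul_comm (a _)]
  · exact (a.continuous.comp continuous_fst).smul ((b.continuous.comp continuous_snd).smul
      (hF.comp (continuous_fst.mul continuous_snd)))
  · refine HasCompactSupport.of_support_subset_isCompact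
      (a.hasCompactSupport.isCompact.prod b.hasCompactSupport.isCompact) fun p hp => ⟨?_, ?_⟩
    · refine subset_tsupport _ fun h => hp ?_
      simp [Function.uncurry, h]
    · refine subset_tsupport _ fun h => hp ?_
      simp [Function.uncurry, h]

end RightTranslation

end GroupAlgebra

/-! ### Weak-* cluster points and a two-sided approximate identity of `L¹(G)`. -/

namespace GroupAlgebra

open CompactlySupported

/-- A bounded family of functionals has a weak-* cluster point. -/
theorem exists_strongDual_of_bounded {ι Y : Type*} [NormedAddCommGroup Y] [NormedSpace ℂ Y]
    (l : Filter ι) [l.NeBot] (T : ι → StrongDual ℂ Y) {C : ℝ} (hT : ∀ i, ‖T i‖ ≤ C) :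
    ∃ φ : StrongDual ℂ Y, ‖φ‖ ≤ C ∧
      ∀ y z, Tendsto (fun i => T i y) l (𝓝 z) → φ y = z := by
  have hc := WeakDual.isCompact_closedBall (𝕜 := ℂ) (0 : StrongDual ℂ Y) C
  obtain ⟨φ, hφ, hle⟩ := hc.ultrafilter_le_nhds
    ((Ultrafilter.of l).map fun i => StrongDual.toWeakDual (T i)) (by
      rw [le_principal_iff, Ultrafilter.mem_coe, Ultrafilter.mem_map]
      refine univ_mem' fun i => ?_
      simpa using hT i)
  refine ⟨WeakDual.toStrongDual φ, by simpa using hφ, fun y z hz => ?_⟩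
  have h1 : Tendsto (fun i => T i y) (Ultrafilter.of l) (𝓝 (φ y)) :=
    ((WeakDual.eval_continuous y).tendsto φ).comp hle
  exact tendsto_nhds_unique h1 (hz.mono_left (Ultrafilter.of_le l))

section ApproximateIdentity

variable {G : Type*} [Group G] [TopologicalSpace G] [IsTopologicalGroup G]
  [LocallyCompactSpace G] [MeasurableSpace G] [BorelSpace G]
  {μ : Measure G} [μ.IsHaarMeasure] [μ.Regular]
  {X : Type*} [NormedAddCommGroup X] [NormedSpace ℂ X]

theorem leftTranslate_one (f : Lp ℂ 1 μ) : leftTranslate (1 : G) f = f := by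
  refine Lp.ext ((Lp.coeFn_compMeasurePreserving _ _).trans ?_)
  simp [Function.comp_def]

variable (μ) in
theorem exists_cc_integral_eq_one {V : Set G} (hV : V ∈ 𝓝 1) :
    ∃ e : C_c(G, ℂ), (∀ t ∉ V, e t = 0) ∧ ∫ t, e t ∂μ = 1 ∧ ‖ccToL1 μ e‖ ≤ 1 := by
  obtain ⟨ψ, h1, hc, hψV, h01⟩ := exists_continuousMap_one_of_isCompact_subset_isOpen
    (isCompact_singleton (x := (1 : G))) isOpen_interior
    (Set.singleton_subset_iff.2 (mem_interior_iff_mem_nhds.2 hV))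
  have hpos : 0 < ∫ s, ψ s ∂μ :=
    ψ.continuous.integral_pos_of_hasCompactSupport_nonneg_nonzero hc (fun t => (h01 t).1)
      (x := 1) (by rw [h1 rfl]; simp)
  let c : ℝ := ∫ s, ψ s ∂μ
  refine ⟨⟨⟨fun t => ((ψ t / c : ℝ) : ℂ),
    Complex.continuous_ofReal.comp (ψ.continuous.div_const c)⟩, ?_⟩, fun t ht => ?_, ?_, ?_⟩
  · exact HasCompactSupport.comp_left (g := fun x : ℝ => ((x / c : ℝ) : ℂ)) hc (by simp)
  · have : ψ t = 0 := image_eq_zero_of_notMem_tsupport fun h => ht (interior_subset (hψV h))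
    show ((ψ t / c : ℝ) : ℂ) = 0
    simp [this]
  · show ∫ t, ((ψ t / c : ℝ) : ℂ) ∂μ = 1
    rw [integral_complex_ofReal, integral_div, div_self hpos.ne', Complex.ofReal_one]
  · rw [norm_ccToL1]
    show ∫ t, ‖((ψ t / c : ℝ) : ℂ)‖ ∂μ ≤ 1
    have : ∀ t, ‖((ψ t / c : ℝ) : ℂ)‖ = ψ t / c := fun t => by
      rw [Complex.norm_real, Real.norm_of_nonneg (div_nonneg (h01 t).1 hpos.le)]
    simp only [this]
    rw [integral_div, div_self hpos.ne']

theorem norm_integral_smul_sub_le [CompleteSpace X] {V : Set G} {e : C_c(G, ℂ)}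
    (he : ∀ t ∉ V, e t = 0) (he1 : ∫ t, e t ∂μ = 1) (hen : ‖ccToL1 μ e‖ ≤ 1) {F : G → X}
    (hF : Continuous F) {C : ℝ} (hC : ∀ t, ‖F t‖ ≤ C) {x : X} {ε : ℝ} (hε : 0 ≤ ε)
    (hx : ∀ t ∈ V, ‖F t - x‖ ≤ ε) : ‖∫ t, e t • F t ∂μ - x‖ ≤ ε := by
  have hi : Integrable (fun t => e t) μ :=
    e.continuous.integrable_of_hasCompactSupport e.hasCompactSupport
  have hiF : Integrable (fun t => e t • F t) μ :=
    (integrable_smul (ccToL1 μ e) hF hC).congr (by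
      filter_upwards [coeFn_ccToL1 (μ := μ) e] with t h
      rw [h])
  have h : ∫ t, e t • F t ∂μ - x = ∫ t, e t • (F t - x) ∂μ := by
    simp only [smul_sub]
    rw [integral_sub hiF (hi.smul_const x), integral_smul_const, he1, one_smul]
  rw [h]
  refine (norm_integral_le_of_norm_le (hi.norm.mul_const ε) (ae_of_all _ fun t => ?_)).trans ?_
  · rw [norm_smul]
    by_cases ht : t ∈ V
    · exact mul_le_mul_of_nonneg_left (hx t ht) (norm_nonneg _)
    · simp [he t ht]
  · rw [integral_mul_const, ← norm_ccToL1]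
    exact mul_le_of_le_one_left hε hen

-- Both limits are averages over shrinking neighbourhoods of 1 of a continuous bounded map into
-- `L¹(G)`: `t ↦ λ_t b` on one side, `t ↦ k * δ_t` with `k` in `C_c(G)` on the other, followed by
-- density.
variable (μ) in
theorem exists_approximate_identity :
    ∃ (l : Filter (Set G)) (e : Set G → C_c(G, ℂ)), l.NeBot ∧ (∀ V, ‖ccToL1 μ (e V)‖ ≤ 1) ∧
      (∀ V, ∫ t, ccToL1 μ (e V) t ∂μ = 1) ∧
      (∀ b : Lp ℂ 1 μ, Tendsto (fun V => ccToL1 μ (e V) * b) l (𝓝 b)) ∧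
      ∀ a : Lp ℂ 1 μ, Tendsto (fun V => a * ccToL1 μ (e V)) l (𝓝 a) := by
  have H : ∀ V : Set G, ∃ e : C_c(G, ℂ), (V ∈ 𝓝 1 → ∀ t ∉ V, e t = 0) ∧ ∫ t, e t ∂μ = 1 ∧
      ‖ccToL1 μ e‖ ≤ 1 := fun V => by
    by_cases hV : V ∈ 𝓝 (1 : G)
    · obtain ⟨e, h⟩ := exists_cc_integral_eq_one μ hV
      exact ⟨e, fun _ => h.1, h.2⟩
    -- A default value: the filter `l` below is concentrated on neighbourhoods of 1.
    · obtain ⟨e, h⟩ := exists_cc_integral_eq_one μ (univ_mem (f := 𝓝 (1 : G)))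
      exact ⟨e, fun h => absurd h hV, h.2⟩
  choose e heV he1 hen using H
  let l : Filter (Set G) := (𝓝 (1 : G)).smallSets ⊓ 𝓟 {V | V ∈ 𝓝 (1 : G)}
  have hl : l.NeBot := by
    refine inf_principal_neBot_iff.2 fun U hU => ?_
    obtain ⟨V, hV, h⟩ := (hasBasis_smallSets _).mem_iff.1 hU
    exact ⟨V, h (Set.mem_powerset subset_rfl), hV⟩
  have key : ∀ (F : G → Lp ℂ 1 μ) (C : ℝ), Continuous F → (∀ t, ‖F t‖ ≤ C) →
      Tendsto (fun V => ∫ t, e V t • F t ∂μ) l (𝓝 (F 1)) := by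
    intro F C hF hC
    rw [Metric.tendsto_nhds]
    intro ε hε
    have hU : {t | ‖F t - F 1‖ ≤ ε / 2} ∈ 𝓝 (1 : G) := by
      have := Metric.tendsto_nhds.1 (hF.tendsto 1) (ε / 2) (by positivity)
      filter_upwards [this] with t ht
      rw [dist_eq_norm] at ht
      exact ht.le
    have h1 : ∀ᶠ V in l, V ⊆ {t | ‖F t - F 1‖ ≤ ε / 2} :=
      mem_inf_of_left (eventually_smallSets_subset.2 hU)
    have h2 : ∀ᶠ V in l, V ∈ 𝓝 (1 : G) := mem_inf_of_right (mem_principal_self _)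
    filter_upwards [h1, h2] with V hV hV1
    rw [dist_eq_norm]
    exact (norm_integral_smul_sub_le (heV V hV1) (he1 V) (hen V) hF hC (by positivity)
      fun t ht => hV ht).trans_lt (by linarith)
  refine ⟨l, e, hl, hen, fun V => (integral_ccToL1 _).trans (he1 V), fun b => ?_, ?_⟩
  · have h := key _ _ (continuous_leftTranslate b) (fun t => (norm_leftTranslate t b).le)
    rw [leftTranslate_one] at h
    refine h.congr fun V => ?_
    exact (integral_ccToL1_smul _ _).symm
  · have hcc : ∀ k : C_c(G, ℂ),
        Tendsto (fun V => ccToL1 μ k * ccToL1 μ (e V)) l (𝓝 (ccToL1 μ k)) := fun k => by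
      have h := key _ _ (continuous_ccRight μ k) (fun t => (norm_ccRight k t).le)
      rw [ccRight_one] at h
      refine h.congr fun V => ?_
      rw [ccToL1_mul_eq_integral]
      exact (integral_ccToL1_smul _ _).symm
    intro a
    rw [Metric.tendsto_nhds]
    intro ε hε
    obtain ⟨k, hk⟩ := Metric.denseRange_iff.1 (denseRange_ccToL1 μ) a (ε / 3) (by positivity)
    filter_upwards [Metric.tendsto_nhds.1 (hcc k) (ε / 3) (by positivity)] with V hV
    have h1 : dist (a * ccToL1 μ (e V)) (ccToL1 μ k * ccToL1 μ (e V)) < ε / 3 := by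
      rw [dist_eq_norm, ← sub_mul]
      rw [dist_eq_norm] at hk
      exact ((norm_mul_le _ _).trans (mul_le_of_le_one_right (norm_nonneg _) (hen V))).trans_lt hk
    have h2 := dist_triangle4 (a * ccToL1 μ (e V)) (ccToL1 μ k * ccToL1 μ (e V)) (ccToL1 μ k) a
    rw [dist_comm] at hk
    linarith

end ApproximateIdentity

/-! ### From an invariant mean to a topologically invariant functional on `L¹(G)*`. -/

section InvariantMean

variable {G : Type*} [Group G] [TopologicalSpace G] [IsTopologicalGroup G]
  [LocallyCompactSpace G] [MeasurableSpace G] [BorelSpace G]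
  {μ : Measure G} [μ.IsHaarMeasure] [μ.Regular]

variable (μ) in
/-- Integration as a functional on `L¹(G)`. -/
def integralL : StrongDual ℂ (Lp ℂ 1 μ) :=
  integrateAgainst (F := fun _ => (1 : ℂ)) (C := 1) continuous_const (by simp)

theorem integralL_apply (f : Lp ℂ 1 μ) : integralL μ f = ∫ t, f t ∂μ := by
  simp [integralL, integrateAgainst_apply]

theorem integralL_mul (f g : Lp ℂ 1 μ) :
    integralL μ (f * g) = integralL μ f * integralL μ g := by
  simp only [integralL_apply, integral_mul_eq]

theorem integralL_leftTranslate (s : G) (f : Lp ℂ 1 μ) :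
    integralL μ (leftTranslate s f) = integralL μ f := by
  have h := integral_translate_smul s f (fun _ => (1 : ℂ))
  simpa only [smul_eq_mul, mul_one, ← integralL_apply] using h

theorem leftTranslate_mul_eq (s : G) (f g : Lp ℂ 1 μ) :
    leftTranslate s (f * g) = leftTranslate s f * g := by
  have h := integral_translate_smul s f (fun t => leftTranslate t g)
  refine Eq.trans ?_ h.symm
  have := (leftTranslateL s).integral_comp_comm (integrable_smul f (continuous_leftTranslate g)
    (fun s => (norm_leftTranslate s g).le))
  refine Eq.trans this.symm ?_
  simp only [map_smul, leftTranslateL_apply, leftTranslate_mul]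
  rfl

theorem memLp_top_apply_leftTranslate (e : Lp ℂ 1 μ) (F : StrongDual ℂ (Lp ℂ 1 μ)) :
    MemLp (fun t => F (leftTranslate t e)) ∞ μ :=
  memLp_top_of_bound (F.continuous.comp (continuous_leftTranslate e)).aestronglyMeasurable
    (‖F‖ * ‖e‖) (ae_of_all _ fun t => (F.le_opNorm _).trans_eq (by rw [norm_leftTranslate]))

/-- The functional `F` on `L¹(G)` is sent to the bounded function `t ↦ F (λ_t e)`. -/
def orbitL (e : Lp ℂ 1 μ) : StrongDual ℂ (Lp ℂ 1 μ) →L[ℂ] Lp ℂ ∞ μ :=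
  LinearMap.mkContinuous
    { toFun := fun F => (memLp_top_apply_leftTranslate e F).toLp _
      map_add' := fun F F' =>
        (memLp_top_apply_leftTranslate e F).toLp_add (memLp_top_apply_leftTranslate e F')
      map_smul' := fun c F => (memLp_top_apply_leftTranslate e F).toLp_const_smul c } ‖e‖ (fun F => by
    show ‖(memLp_top_apply_leftTranslate e F).toLp _‖ ≤ _
    rw [Lp.norm_toLp, eLpNorm_exponent_top]
    refine ENNReal.toReal_le_of_le_ofReal (by positivity) ?_
    refine eLpNormEssSup_le_of_ae_bound (ae_of_all _ fun t => (F.le_opNorm _).trans_eq ?_)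
    rw [norm_leftTranslate, mul_comm])

theorem orbitL_apply (e : Lp ℂ 1 μ) (F : StrongDual ℂ (Lp ℂ 1 μ)) :
    orbitL e F = (memLp_top_apply_leftTranslate e F).toLp _ := rfl

theorem leftTranslate_orbitL (e : Lp ℂ 1 μ) (F : StrongDual ℂ (Lp ℂ 1 μ)) (s : G) :
    leftTranslate s (orbitL e F) = orbitL e (F ∘L leftTranslateL s⁻¹) := by
  rw [leftTranslate, orbitL_apply, Lp.toLp_compMeasurePreserving, orbitL_apply]
  refine MemLp.toLp_congr _ _ (ae_of_all _ fun t => ?_)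
  simp [leftTranslateL_apply, leftTranslate_mul]

/-- An amenable group has a topologically left invariant mean, here as a functional on `L¹(G)*`. -/
theorem IsAmenable.exists_topologically_invariant (h : IsAmenable μ) :
    ∃ m : StrongDual ℂ (StrongDual ℂ (Lp ℂ 1 μ)), m (integralL μ) = 1 ∧
      ∀ F f, m (F ∘L ContinuousLinearMap.mul ℂ (Lp ℂ 1 μ) f) = integralL μ f * m F := by
  obtain ⟨M, -, hM1, hM⟩ := h
  obtain ⟨l, e, hl, hen, he1, hleft, -⟩ := exists_approximate_identity μ
  set e₀ : Lp ℂ 1 μ := ccToL1 μ (e Set.univ) with he₀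
  have he₀1 : integralL μ e₀ = 1 := (integralL_apply _).trans (he1 _)
  let m₀ := M ∘L orbitL e₀
  have hm₀ : ∀ F s, m₀ (F ∘L leftTranslateL s) = m₀ F := fun F s => by
    have := hM s⁻¹ (orbitL e₀ F)
    rwa [leftTranslate_orbitL, inv_inv] at this
  -- For fixed `F`, the functional `a ↦ m₀(F(a ·))` is invariant under right translation of `a`.
  -- Integrating this gives `ν F (a * b) = ν F a ∫ b`, and an approximate identity in place of `a`
  -- makes `ν F` a multiple of integration.
  let ν : StrongDual ℂ (Lp ℂ 1 μ) → StrongDual ℂ (Lp ℂ 1 μ) := fun F =>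
    m₀ ∘L ContinuousLinearMap.compL ℂ _ _ _ F ∘L ContinuousLinearMap.mul ℂ (Lp ℂ 1 μ)
  have hν : ∀ F a, ν F a = m₀ (F ∘L ContinuousLinearMap.mul ℂ (Lp ℂ 1 μ) a) := fun _ _ => rfl
  have hνR : ∀ F k s, ν F (ccToL1 μ (ccRight k s)) = ν F (ccToL1 μ k) := fun F k s => by
    refine Eq.trans (congrArg m₀ ?_) (hm₀ _ s)
    ext g
    simp [ccRight_mul, leftTranslateL_apply]
  have hνm : ∀ F a b, ν F (a * b) = ν F a * integralL μ b := fun F a b => by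
    suffices H : (fun a => ν F (a * b)) = fun a => ν F a * integralL μ b from congrFun H a
    refine (denseRange_ccToL1 μ).equalizer
      ((ν F).continuous.comp (continuous_id.mul continuous_const))
      ((ν F).continuous.mul continuous_const) (funext fun k => ?_)
    simp only [Function.comp_apply]
    rw [ccToL1_mul_eq_integral]
    refine ((ν F).integral_comp_comm (integrable_smul b (continuous_ccRight μ k)
      (fun t => (norm_ccRight k t).le))).symm.trans ?_
    simp only [map_smul, hνR, smul_eq_mul, integral_mul_const]
    rw [mul_comm, integralL_apply]
  have hνi : ∀ F b, Tendsto (fun V => ν F (ccToL1 μ (e V)) * integralL μ b) l (𝓝 (ν F b)) :=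
    fun F b => by
      have := ((ν F).continuous.tendsto _).comp (hleft b)
      refine this.congr fun V => ?_
      rw [Function.comp_apply, hνm]
  have hνc : ∀ F b, ν F b = integralL μ b * ν F e₀ := fun F b => by
    refine tendsto_nhds_unique (hνi F b) ?_
    have := (hνi F e₀).mul_const (integralL μ b)
    simp only [he₀1, mul_one] at this
    rwa [mul_comm]
  refine ⟨m₀ ∘L ContinuousLinearMap.precomp ℂ (ContinuousLinearMap.mul ℂ (Lp ℂ 1 μ) e₀), ?_, ?_⟩
  · have h1 : (integralL μ) ∘L ContinuousLinearMap.mul ℂ (Lp ℂ 1 μ) e₀ = integralL μ := by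
      ext f
      simp [integralL_mul, he₀1]
    show m₀ ((integralL μ) ∘L ContinuousLinearMap.mul ℂ (Lp ℂ 1 μ) e₀) = 1
    rw [h1, ← hM1]
    show M (orbitL e₀ (integralL μ)) = _
    congr 1
    rw [orbitL_apply]
    refine MemLp.toLp_congr _ _ (ae_of_all _ fun t => ?_)
    simp only [integralL_leftTranslate, he₀1]
  · intro F f
    show m₀ ((F ∘L ContinuousLinearMap.mul ℂ (Lp ℂ 1 μ) f) ∘L
      ContinuousLinearMap.mul ℂ (Lp ℂ 1 μ) e₀) = integralL μ f * ν F e₀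
    have : (F ∘L ContinuousLinearMap.mul ℂ (Lp ℂ 1 μ) f) ∘L
      ContinuousLinearMap.mul ℂ (Lp ℂ 1 μ) e₀ = F ∘L ContinuousLinearMap.mul ℂ (Lp ℂ 1 μ)
        (f * e₀) := by
      ext g
      simp [mul_assoc]
    rw [this, ← hν, hνc, integralL_mul, he₀1, mul_one]

end InvariantMean

end GroupAlgebra

/-! ### From an invariant functional on `L¹(G)*` to an invariant mean. -/

namespace GroupAlgebra

theorem exists_strongDual_eq_zero_of_notMem_closure {Y : Type*} [NormedAddCommGroup Y]
    [NormedSpace ℂ Y] (p : Submodule ℂ Y) {x : Y} (hx : x ∉ closure (p : Set Y)) :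
    ∃ f : StrongDual ℂ Y, (∀ a ∈ p, f a = 0) ∧ f x ≠ 0 := by
  have : NormedSpace ℝ Y := NormedSpace.restrictScalars ℝ ℂ Y
  have hconv : Convex ℝ (closure (p : Set Y)) := (p.restrictScalars ℝ).convex.closure
  obtain ⟨f, u, hfu, hux⟩ := RCLike.geometric_hahn_banach_closed_point (𝕜 := ℂ) hconv
    isClosed_closure hx
  have hu : 0 < u := by simpa using hfu 0 (subset_closure p.zero_mem)
  refine ⟨f, fun a ha => ?_, fun h => ?_⟩
  · by_contra h
    -- A nonzero value of `f` on the subspace could be rescaled to equal the bound `u`.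
    have := hfu (((u : ℂ) / f a) • a) (subset_closure (p.smul_mem _ ha))
    rw [map_smul, smul_eq_mul, div_mul_cancel₀ _ h] at this
    simp at this
  · rw [h] at hux
    simp only [map_zero] at hux
    exact hu.not_gt hux

section InvariantMean

variable {G : Type*} [Group G] [TopologicalSpace G] [IsTopologicalGroup G]
  [LocallyCompactSpace G] [MeasurableSpace G] [BorelSpace G]
  {μ : Measure G} [μ.IsHaarMeasure] [μ.Regular]

/-- Day's convexity argument, in linear form. If `(0, 1)` were not in the closure of the range of `f
↦ ((λ_s f - f)_s, ∫ f)`, a functional vanishing on that range would express a nonzero multiple of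
integration as a sum of terms `F - F ∘ λ_s`. All these are killed by `m`, but integration is not. -/
theorem exists_norm_leftTranslate_sub_lt {m : StrongDual ℂ (StrongDual ℂ (Lp ℂ 1 μ))}
    (hm1 : m (integralL μ) = 1) (hm : ∀ F s, m (F ∘L leftTranslateL s) = m F) (S : Finset G)
    {ε : ℝ} (hε : 0 < ε) :
    ∃ f : Lp ℂ 1 μ, (∀ s ∈ S, ‖leftTranslate s f - f‖ < ε) ∧ ‖integralL μ f - 1‖ < ε := by
  classical
  let T : Lp ℂ 1 μ →L[ℂ] (S → Lp ℂ 1 μ) × ℂ :=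
    (ContinuousLinearMap.pi fun s : S => leftTranslateL (s : G) - ContinuousLinearMap.id ℂ _).prod
      (integralL μ)
  have hmem : ((0, 1) : (S → Lp ℂ 1 μ) × ℂ) ∈ closure (T.toLinearMap.range : Set _) := by
    by_contra hx
    obtain ⟨Λ, hΛ, hΛ1⟩ := exists_strongDual_eq_zero_of_notMem_closure _ hx
    let Λs : S → StrongDual ℂ (Lp ℂ 1 μ) := fun s =>
      Λ ∘L ContinuousLinearMap.inl ℂ _ _ ∘L ContinuousLinearMap.single ℂ (fun _ : S => Lp ℂ 1 μ) s
    have hsum : Λ (0, 1) • integralL μ + ∑ s : S, (Λs s ∘L leftTranslateL (s : G) - Λs s) = 0 := by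
      ext f
      have h := hΛ (T f) ⟨f, rfl⟩
      have e : T f = integralL μ f • ((0 : S → Lp ℂ 1 μ), (1 : ℂ)) +
          ∑ s : S, (Pi.single s (leftTranslateL (s : G) f - f), (0 : ℂ)) := by
        refine Prod.ext ?_ ?_
        · rw [Prod.fst_add, Prod.fst_sum, Finset.univ_sum_single]
          simp only [Prod.smul_fst, smul_zero, zero_add]
          rfl
        · rw [Prod.snd_add, Prod.snd_sum]
          simp [T]
      rw [e, map_add, map_smul, map_sum] at h
      refine Eq.trans ?_ h
      simp only [add_apply, smul_apply, smul_eq_mul,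
        sum_apply]
      rw [mul_comm]
      refine congrArg _ (Finset.sum_congr rfl fun s _ => ?_)
      exact ((Λs s).map_sub _ _).symm
    have h := congrArg m hsum
    rw [map_add, map_smul, map_sum, map_zero, hm1] at h
    simp only [map_sub, hm, sub_self, Finset.sum_const_zero, add_zero, smul_eq_mul, mul_one] at h
    exact hΛ1 h
  obtain ⟨_, ⟨f, rfl⟩, hf⟩ := Metric.mem_closure_iff.1 hmem ε hε
  rw [dist_comm, dist_eq_norm] at hf
  refine ⟨f, fun s hs => ?_, (norm_snd_le _).trans_lt hf⟩
  have h := ((norm_le_pi_norm _ (⟨s, hs⟩ : S)).trans (norm_fst_le _)).trans_lt hf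
  simpa [T, leftTranslateL_apply] using h

theorem lipschitzWith_ofReal_norm : LipschitzWith 1 fun z : ℂ => ((‖z‖ : ℝ) : ℂ) :=
  LipschitzWith.of_dist_le_mul fun x y => by
    rw [dist_eq_norm, ← Complex.ofReal_sub, Complex.norm_real, NNReal.coe_one, one_mul,
      dist_eq_norm]
    exact abs_norm_sub_norm_le x y

/-- The absolute value of an element of `L¹(G)`. -/
def absL1 (f : Lp ℂ 1 μ) : Lp ℂ 1 μ := lipschitzWith_ofReal_norm.compLp (by simp) f

theorem coeFn_absL1 (f : Lp ℂ 1 μ) : absL1 f =ᵐ[μ] fun t => ((‖f t‖ : ℝ) : ℂ) :=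
  LipschitzWith.coeFn_compLp _ _ _

theorem norm_absL1_sub_le (f g : Lp ℂ 1 μ) : ‖absL1 f - absL1 g‖ ≤ ‖f - g‖ :=
  (lipschitzWith_ofReal_norm.norm_compLp_sub_le (by simp) f g).trans_eq (by simp)

theorem norm_absL1 (f : Lp ℂ 1 μ) : ‖absL1 f‖ = ‖f‖ := by
  rw [L1.norm_eq_integral_norm, L1.norm_eq_integral_norm]
  refine integral_congr_ae ?_
  filter_upwards [coeFn_absL1 f] with t h
  rw [h, Complex.norm_real, norm_norm]

theorem integralL_absL1 (f : Lp ℂ 1 μ) : integralL μ (absL1 f) = ‖f‖ := by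
  rw [integralL_apply, L1.norm_eq_integral_norm, ← integral_complex_ofReal]
  exact integral_congr_ae (coeFn_absL1 f)

theorem leftTranslate_absL1 (s : G) (f : Lp ℂ 1 μ) :
    leftTranslate s (absL1 f) = absL1 (leftTranslate s f) := by
  refine Lp.ext ?_
  have hs := measurePreserving_mul_left μ s⁻¹
  filter_upwards [Lp.coeFn_compMeasurePreserving (absL1 f) hs,
    hs.quasiMeasurePreserving.ae (coeFn_absL1 f), coeFn_absL1 (leftTranslate s f),
    Lp.coeFn_compMeasurePreserving f hs] with t h1 h2 h3 h4
  rw [h3]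
  refine h1.trans (h2.trans ?_)
  exact congrArg (fun z : ℂ => ((‖z‖ : ℝ) : ℂ)) h4.symm

theorem norm_integralL_le (f : Lp ℂ 1 μ) : ‖integralL μ f‖ ≤ ‖f‖ := by
  rw [integralL_apply, L1.norm_eq_integral_norm]
  exact norm_integral_le_integral_norm _

/-- The density is `|f| / ‖f‖`, as taking absolute values commutes with translation and does not
increase distances. From `|∫ f - 1| < 1/2` follows `‖f‖ ≥ 1/2`, so an error of `ε/2` for `f` becomes
at most `ε`. -/
theorem exists_density_norm_leftTranslate_sub_le {m : StrongDual ℂ (StrongDual ℂ (Lp ℂ 1 μ))}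
    (hm1 : m (integralL μ) = 1) (hm : ∀ F s, m (F ∘L leftTranslateL s) = m F) (S : Finset G)
    {ε : ℝ} (hε : 0 < ε) :
    ∃ g : Lp ℂ 1 μ, ‖g‖ = 1 ∧ integralL μ g = 1 ∧ ∀ s ∈ S, ‖leftTranslate s g - g‖ ≤ ε := by
  obtain ⟨f, hf, hf1⟩ := exists_norm_leftTranslate_sub_lt hm1 hm S
    (lt_min (half_pos hε) (one_half_pos (α := ℝ)))
  have hfn : 1 / 2 ≤ ‖f‖ := by
    have h1 := hf1.trans_le (min_le_right _ _)
    have h2 := norm_sub_norm_le (1 : ℂ) (integralL μ f)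
    rw [norm_sub_rev, norm_one] at h2
    linarith [norm_integralL_le f]
  have hpos : 0 < ‖f‖ := by linarith
  have hne : ((‖f‖ : ℝ) : ℂ) ≠ 0 := by exact_mod_cast hpos.ne'
  have hnn : ‖((‖f‖ : ℝ) : ℂ)⁻¹‖ = ‖f‖⁻¹ := by rw [norm_inv, Complex.norm_real, norm_norm]
  refine ⟨((‖f‖ : ℝ) : ℂ)⁻¹ • absL1 f, ?_, ?_, fun s hs => ?_⟩
  · rw [norm_smul, hnn, norm_absL1, inv_mul_cancel₀ hpos.ne']
  · rw [map_smul, integralL_absL1, smul_eq_mul, inv_mul_cancel₀ hne]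
  · rw [leftTranslate_smul, leftTranslate_absL1, ← smul_sub, norm_smul, hnn,
      inv_mul_le_iff₀ hpos]
    have h1 := (hf s hs).le.trans (min_le_left _ _)
    have h2 := norm_absL1_sub_le (leftTranslate s f) f
    nlinarith

theorem ae_norm_le_norm_top (φ : Lp ℂ ∞ μ) : ∀ᵐ t ∂μ, ‖φ t‖ ≤ ‖φ‖ := by
  have hfin : eLpNormEssSup φ μ ≠ ∞ := by
    rw [← eLpNorm_exponent_top]
    exact Lp.eLpNorm_ne_top φ
  filter_upwards [ae_le_eLpNormEssSup (f := φ) (μ := μ)] with t h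
  rw [Lp.norm_def, eLpNorm_exponent_top]
  simpa using ENNReal.toReal_mono hfin h

variable (μ) in
/-- The pairing `(g, φ) ↦ ∫ g φ` of `L¹(G)` and `L^∞(G)`. -/
def pairL : Lp ℂ 1 μ →L[ℂ] Lp ℂ ∞ μ →L[ℂ] ℂ :=
  ContinuousLinearMap.lpPairing μ 1 ∞ (ContinuousLinearMap.mul ℂ ℂ)

theorem pairL_apply (g : Lp ℂ 1 μ) (φ : Lp ℂ ∞ μ) : pairL μ g φ = ∫ t, g t • φ t ∂μ :=
  ContinuousLinearMap.lpPairing_eq_integral _ _ _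

theorem norm_pairL_le (g : Lp ℂ 1 μ) (φ : Lp ℂ ∞ μ) : ‖pairL μ g φ‖ ≤ ‖g‖ * ‖φ‖ := by
  rw [pairL_apply, L1.norm_eq_integral_norm, ← integral_mul_const]
  refine norm_integral_le_of_norm_le ((L1.integrable_coeFn g).norm.mul_const _) ?_
  filter_upwards [ae_norm_le_norm_top φ] with t h
  rw [norm_smul]
  exact mul_le_mul_of_nonneg_left h (norm_nonneg _)

theorem pairL_leftTranslate (g : Lp ℂ 1 μ) (φ : Lp ℂ ∞ μ) (s : G) :
    pairL μ g (leftTranslate s φ) = pairL μ (leftTranslate s⁻¹ g) φ := by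
  rw [pairL_apply, pairL_apply, integral_translate_smul]
  refine integral_congr_ae ?_
  filter_upwards [Lp.coeFn_compMeasurePreserving φ (measurePreserving_mul_left μ s⁻¹)] with t h
  exact congrArg (g t • ·) h

/-- A left invariant functional on `L¹(G)*` with `m(∫) = 1` makes `G` amenable. -/
theorem isAmenable_of_invariant {m : StrongDual ℂ (StrongDual ℂ (Lp ℂ 1 μ))}
    (hm1 : m (integralL μ) = 1) (hm : ∀ F s, m (F ∘L leftTranslateL s) = m F) :
    IsAmenable μ := by
  classical
  choose g hg hg1 hgS using fun i : Finset G × ℕ =>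
    exists_density_norm_leftTranslate_sub_le hm1 hm i.1 (ε := 1 / ((i.2 : ℝ) + 1)) (by positivity)
  -- The mean is a weak-* cluster point of densities that are `1/(n+1)`-invariant under a finite set
  -- `S`, along growing pairs `(S, n)`.
  obtain ⟨M, hM, hlim⟩ := exists_strongDual_of_bounded (atTop : Filter (Finset G × ℕ))
    (fun i => pairL μ (g i)) (C := 1) fun i =>
      ContinuousLinearMap.opNorm_le_bound _ zero_le_one fun φ => by
        simpa [hg] using norm_pairL_le (g i) φ
  let one : Lp ℂ ∞ μ := (memLp_top_const (1 : ℂ)).toLp _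
  have hone : ‖one‖ ≤ 1 := by
    rw [Lp.norm_toLp, eLpNorm_exponent_top]
    exact ENNReal.toReal_le_of_le_ofReal zero_le_one
      (eLpNormEssSup_le_of_ae_bound (ae_of_all _ fun t => by simp))
  have hM1 : M one = 1 := by
    refine hlim _ _ (tendsto_const_nhds.congr fun i => ?_)
    rw [← hg1 i, integralL_apply, pairL_apply]
    refine integral_congr_ae ?_
    filter_upwards [(memLp_top_const (μ := μ) (1 : ℂ)).coeFn_toLp] with t h
    rw [h, smul_eq_mul, mul_one]
  refine ⟨M, le_antisymm hM ?_, hM1, fun s φ => ?_⟩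
  · have := M.le_opNorm one
    rw [hM1, norm_one] at this
    nlinarith [norm_nonneg M]
  · rw [← sub_eq_zero, ← map_sub]
    refine hlim _ _ ?_
    have hz : Tendsto (fun i : Finset G × ℕ => 1 / ((i.2 : ℝ) + 1) * ‖φ‖) atTop (𝓝 0) := by
      rw [← prod_atTop_atTop_eq]
      simpa using (tendsto_one_div_add_atTop_nhds_zero_nat.comp tendsto_snd).mul_const ‖φ‖
    refine squeeze_zero_norm' ?_ hz
    filter_upwards [eventually_ge_atTop (({s⁻¹}, 0) : Finset G × ℕ)] with i hi
    have hs : s⁻¹ ∈ i.1 := hi.1 (Finset.mem_singleton_self _)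
    rw [map_sub, pairL_leftTranslate, ← sub_apply, ← map_sub]
    exact (norm_pairL_le _ _).trans
      (mul_le_mul_of_nonneg_right (hgS i _ hs) (norm_nonneg _))

end InvariantMean

end GroupAlgebra

namespace GroupAlgebra

/-! ### Property (CB) as a right identity in the bidual. -/

section VirtualRightIdentity

/-- `B` has a virtual right identity: an element `φ` of the bidual with `a • φ = a` for all `a`. -/
def HasVirtualRightIdentity (B : Type*) [NonUnitalNormedRing B] [NormedSpace ℂ B]
    [IsScalarTower ℂ B B] [SMulCommClass ℂ B B] : Prop :=
  ∃ φ : StrongDual ℂ (StrongDual ℂ B),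
    ∀ (F : StrongDual ℂ B) (a : B), φ (F ∘L ContinuousLinearMap.mul ℂ B a) = F a

/-- The module property says that `b ↦ Ξ(b)(Φ(a) x)` is `b ↦ Ξ(a b)(x)`, and `φ` sends the latter to
`Ξ(a)(x)`. -/
theorem HasVirtualRightIdentity.hasPropertyCB {B : Type u} [NonUnitalNormedRing B]
    [NormedSpace ℂ B] [IsScalarTower ℂ B B] [SMulCommClass ℂ B B]
    (h : HasVirtualRightIdentity B) : HasPropertyCB.{u, v} B := by
  intro E _ _ _ Φ Ξ _ hΞ
  obtain ⟨φ, hφ⟩ := h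
  refine ⟨φ ∘L Ξ.flip, fun a => ?_⟩
  ext x
  have : Ξ.flip (Φ a x) = Ξ.flip x ∘L ContinuousLinearMap.mul ℂ B a := by
    ext b
    simp [hΞ]
  simp [this, hφ]

/-- The test module is `E = B*` with `Φ(a) F = F(a ·)`, and `Ξ` is the embedding in the bidual. The
lift only adjusts the universe of `E`. -/
theorem HasPropertyCB.hasVirtualRightIdentity {B : Type u} [NonUnitalNormedRing B]
    [NormedSpace ℂ B] [IsScalarTower ℂ B B] [SMulCommClass ℂ B B]
    (h : HasPropertyCB.{u, max u v} B) : HasVirtualRightIdentity B := by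
  let down : ULift.{v} (StrongDual ℂ B) →L[ℂ] StrongDual ℂ B :=
    (ContinuousLinearEquiv.ulift : ULift.{v} (StrongDual ℂ B) ≃L[ℂ] _).toContinuousLinearMap
  let up : StrongDual ℂ B →L[ℂ] ULift.{v} (StrongDual ℂ B) :=
    (ContinuousLinearEquiv.ulift : ULift.{v} (StrongDual ℂ B) ≃L[ℂ] _).symm.toContinuousLinearMap
  obtain ⟨φ, hφ⟩ := h (ULift.{v} (StrongDual ℂ B))
    (ContinuousLinearMap.compL ℂ _ _ _ up ∘L
      (ContinuousLinearMap.compL ℂ _ (StrongDual ℂ B) (StrongDual ℂ B)).flip down ∘L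
      (ContinuousLinearMap.compL ℂ B B ℂ).flip ∘L ContinuousLinearMap.mul ℂ B)
    ((ContinuousLinearMap.compL ℂ _ (StrongDual ℂ B) ℂ).flip down ∘L
      NormedSpace.inclusionInDoubleDual ℂ B)
    (fun a b => by
      ext F c
      show F.down (a * b * c) = F.down (a * (b * c))
      rw [mul_assoc])
    (fun a b => rfl)
  refine ⟨φ ∘L up, fun F a => ?_⟩
  exact (congrArg (fun ψ => ψ (ULift.up F)) (hφ a)).symm

instance instNormedSpaceNonUnitalSubalgebra {A : Type*} [NonUnitalNormedRing A] [NormedSpace ℂ A]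
    (S : NonUnitalSubalgebra ℂ A) : NormedSpace ℂ S :=
  { (inferInstance : Module ℂ S) with norm_smul_le := fun c a => norm_smul_le c (a : A) }

end VirtualRightIdentity

/-! ### Right identities for the two ideals of mass zero. -/

section Ideals

variable {G : Type*} [Group G] [TopologicalSpace G] [IsTopologicalGroup G]
  [LocallyCompactSpace G] [MeasurableSpace G] [BorelSpace G]
  {μ : Measure G} [μ.IsHaarMeasure] [μ.Regular]

theorem mem_L10_iff {f : Lp ℂ 1 μ} : f ∈ L10 μ ↔ integralL μ f = 0 := by
  rw [integralL_apply]
  rfl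

variable (μ) in
/-- The inclusion of `L¹₀(G)` in `L¹(G)`. -/
def inclL10 : L10 μ →L[ℂ] Lp ℂ 1 μ :=
  ⟨{ toFun := Subtype.val, map_add' := fun _ _ => rfl, map_smul' := fun _ _ => rfl },
    continuous_subtype_val⟩

theorem inclL10_apply (a : L10 μ) : inclL10 μ a = a := rfl

/-- The projection `f ↦ f - (∫ f) e` of `L¹(G)` onto `L¹₀(G)`, where `∫ e = 1`. -/
def projL10 (e : Lp ℂ 1 μ) (he : integralL μ e = 1) : Lp ℂ 1 μ →L[ℂ] L10 μ :=
  ⟨{ toFun := fun f => ⟨f - integralL μ f • e, mem_L10_iff.2 (by simp [he])⟩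
     map_add' := fun f g => Subtype.ext (by simp [add_smul]; abel)
     map_smul' := fun c f => Subtype.ext (by simp [smul_sub, mul_smul]) },
    Continuous.subtype_mk (by fun_prop) _⟩

theorem coe_projL10 (e : Lp ℂ 1 μ) (he : integralL μ e = 1) (f : Lp ℂ 1 μ) :
    (projL10 e he f : Lp ℂ 1 μ) = f - integralL μ f • e := rfl

variable (μ) in
/-- The bidual of `L¹(G)` has a right identity on which integration takes the value `1`. -/
theorem exists_right_identity_bidual :
    ∃ E : StrongDual ℂ (StrongDual ℂ (Lp ℂ 1 μ)), E (integralL μ) = 1 ∧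
      ∀ F a, E (F ∘L ContinuousLinearMap.mul ℂ (Lp ℂ 1 μ) a) = F a := by
  obtain ⟨l, e, hl, hen, he1, -, hr⟩ := exists_approximate_identity μ
  obtain ⟨E, -, hE⟩ := exists_strongDual_of_bounded l
    (fun V => NormedSpace.inclusionInDoubleDual ℂ (Lp ℂ 1 μ) (ccToL1 μ (e V))) (C := 1)
    fun V => (NormedSpace.double_dual_bound ℂ _ _).trans (hen V)
  refine ⟨E, hE _ _ (tendsto_const_nhds.congr fun V => ?_), fun F a => hE _ _ ?_⟩
  · rw [NormedSpace.dual_def, integralL_apply, he1]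
  · exact (F.continuous.tendsto a).comp (hr a)

/-- In the bidual of `L¹(G)`, `a (E - m) = a - (∫ a) m = a` for `a` in `L10 μ`. The projection `P`
carries `E - m` to the bidual of the ideal. -/
theorem IsAmenable.hasVirtualRightIdentity_L10 (h : IsAmenable μ) :
    HasVirtualRightIdentity (L10 μ) := by
  obtain ⟨m, hm1, hm⟩ := h.exists_topologically_invariant
  obtain ⟨E, hE1, hE⟩ := exists_right_identity_bidual μ
  obtain ⟨e, -, he, -⟩ := exists_cc_integral_eq_one μ (univ_mem (f := 𝓝 (1 : G)))
  have he₀ : integralL μ (ccToL1 μ e) = 1 := by rw [integralL_apply, integral_ccToL1, he]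
  let P := projL10 (ccToL1 μ e) he₀
  refine ⟨(E - m) ∘L ContinuousLinearMap.precomp ℂ P, fun F a => ?_⟩
  have ha : integralL μ (a : Lp ℂ 1 μ) = 0 := mem_L10_iff.1 a.2
  let c : L10 μ := ⟨(a : Lp ℂ 1 μ) * ccToL1 μ e, mem_L10_iff.2 (by simp [integralL_mul, ha])⟩
  -- `P` is not a module map; its defect contributes a multiple of integration, which `E - m`
  -- annihilates.
  have hP : ∀ f, a * P f = P ((a : Lp ℂ 1 μ) * f) - integralL μ f • c := fun f => by
    refine Subtype.ext ?_
    show (a : Lp ℂ 1 μ) * (f - integralL μ f • ccToL1 μ e) =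
      ((a : Lp ℂ 1 μ) * f - integralL μ ((a : Lp ℂ 1 μ) * f) • ccToL1 μ e) -
        integralL μ f • ((a : Lp ℂ 1 μ) * ccToL1 μ e)
    rw [integralL_mul, ha, zero_mul, zero_smul, sub_zero, mul_sub, mul_smul_comm]
  have key : (F ∘L ContinuousLinearMap.mul ℂ (L10 μ) a) ∘L P =
      (F ∘L P) ∘L ContinuousLinearMap.mul ℂ (Lp ℂ 1 μ) a - F c • integralL μ := by
    ext f
    show F (a * P f) = F (P ((a : Lp ℂ 1 μ) * f)) - F c * integralL μ f
    rw [hP, map_sub, map_smul, smul_eq_mul, mul_comm]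
  show (E - m) ((F ∘L ContinuousLinearMap.mul ℂ (L10 μ) a) ∘L P) = F a
  rw [key, map_sub, map_smul]
  simp only [sub_apply, hE, hm, hm1, hE1, ha, zero_mul, sub_self, smul_zero, sub_zero]
  show F (P a) = F a
  congr 1
  refine Subtype.ext ?_
  rw [coe_projL10, ha, zero_smul, sub_zero]

theorem mem_tildeL10_iff {a : UnitalL1 μ} :
    a ∈ tildeL10 μ ↔ a.ofLp.fst = -integralL μ a.ofLp.snd := by
  rw [integralL_apply]
  rfl

variable (μ) in
/-- The `L¹(G)`-component of an element of `tildeL10 μ`. -/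
def sndTilde : tildeL10 μ →L[ℂ] Lp ℂ 1 μ :=
  LinearMap.mkContinuous
    { toFun := fun a => a.1.ofLp.snd
      map_add' := fun _ _ => rfl
      map_smul' := fun _ _ => rfl } 1 fun a => by
    rw [one_mul]
    show ‖a.1.ofLp.snd‖ ≤ ‖a.1‖
    rw [WithLp.unitization_norm_def]
    exact le_add_of_nonneg_left (norm_nonneg _)

variable (μ) in
/-- The isomorphism `f ↦ (f, -∫ f)` of `L¹(G)` onto `tildeL10 μ`. -/
def toTilde : Lp ℂ 1 μ →L[ℂ] tildeL10 μ :=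
  LinearMap.mkContinuous
    { toFun := fun f => ⟨WithLp.toLp 1 (Unitization.inl (-integralL μ f) + Unitization.inr f),
        mem_tildeL10_iff.2 (by simp)⟩
      map_add' := fun f g => Subtype.ext (WithLp.ofLp_injective 1 (Unitization.ext
        (by simp; ring) (by simp)))
      map_smul' := fun c f => Subtype.ext (WithLp.ofLp_injective 1 (Unitization.ext
        (by simp) (by simp))) } 2 fun f => by
    show ‖(WithLp.toLp 1 (Unitization.inl (-integralL μ f) + Unitization.inr f) : UnitalL1 μ)‖ ≤ _
    rw [WithLp.unitization_norm_def]
    have := norm_integralL_le f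
    simp only [Unitization.fst_add, Unitization.fst_inl, Unitization.fst_inr, add_zero,
      Unitization.snd_add, Unitization.snd_inl, Unitization.snd_inr, zero_add, norm_neg]
    linarith

theorem sndTilde_mul (a b : tildeL10 μ) : sndTilde μ (a * b) =
    sndTilde μ a * sndTilde μ b - integralL μ (sndTilde μ b) • sndTilde μ a -
      integralL μ (sndTilde μ a) • sndTilde μ b := by
  show a.1.ofLp.fst • b.1.ofLp.snd + b.1.ofLp.fst • a.1.ofLp.snd + a.1.ofLp.snd * b.1.ofLp.snd = _
  rw [mem_tildeL10_iff.1 a.2, mem_tildeL10_iff.1 b.2]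
  show -integralL μ (sndTilde μ a) • sndTilde μ b + -integralL μ (sndTilde μ b) • sndTilde μ a +
    sndTilde μ a * sndTilde μ b = _
  simp only [neg_smul]
  abel

theorem sndTilde_toTilde (f : Lp ℂ 1 μ) : sndTilde μ (toTilde μ f) = f := zero_add f

theorem toTilde_sndTilde (a : tildeL10 μ) : toTilde μ (sndTilde μ a) = a :=
  Subtype.ext (WithLp.ofLp_injective 1 (Unitization.ext
    ((add_zero _).trans (mem_tildeL10_iff.1 a.2).symm) (zero_add _)))

theorem mul_toTilde (a : tildeL10 μ) (f : Lp ℂ 1 μ) : a * toTilde μ f =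
    toTilde μ (sndTilde μ a * f) - integralL μ f • a -
      integralL μ (sndTilde μ a) • toTilde μ f := by
  rw [← toTilde_sndTilde (a * toTilde μ f), sndTilde_mul, sndTilde_toTilde]
  simp only [map_sub, map_smul, toTilde_sndTilde]

/-- The right identity is `δ - m`, whose `L¹(G)`-component is `-m`; the coefficient of `δ` is
determined by that component. -/
theorem IsAmenable.hasVirtualRightIdentity_tildeL10 (h : IsAmenable μ) :
    HasVirtualRightIdentity (tildeL10 μ) := by
  obtain ⟨m, hm1, hm⟩ := h.exists_topologically_invariant
  refine ⟨(-m) ∘L ContinuousLinearMap.precomp ℂ (toTilde μ), fun F a => ?_⟩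
  have key : (F ∘L ContinuousLinearMap.mul ℂ (tildeL10 μ) a) ∘L toTilde μ =
      (F ∘L toTilde μ) ∘L ContinuousLinearMap.mul ℂ (Lp ℂ 1 μ) (sndTilde μ a) -
        F a • integralL μ - integralL μ (sndTilde μ a) • (F ∘L toTilde μ) := by
    ext f
    simp [mul_toTilde, mul_comm]
  show -m ((F ∘L ContinuousLinearMap.mul ℂ (tildeL10 μ) a) ∘L toTilde μ) = F a
  rw [key, map_sub, map_sub, hm, map_smul, map_smul, hm1]
  simp

theorem isAmenable_of_hasVirtualRightIdentity_tildeL10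
    (h : HasVirtualRightIdentity (tildeL10 μ)) : IsAmenable μ := by
  obtain ⟨φ, hφ⟩ := h
  obtain ⟨e', -, he', -⟩ := exists_cc_integral_eq_one μ (univ_mem (f := 𝓝 (1 : G)))
  set e := ccToL1 μ e' with he_def
  have he : integralL μ e = 1 := by rw [integralL_apply, integral_ccToL1, he']
  -- `A a b` is the product `a b` in the unitalization, which lies in the ideal `L¹(G)`. Thus the
  -- `m` below is `e - e φ`.
  let A : Lp ℂ 1 μ → tildeL10 μ →L[ℂ] Lp ℂ 1 μ := fun a =>
    ContinuousLinearMap.mul ℂ (Lp ℂ 1 μ) a ∘L sndTilde μ - (integralL μ ∘L sndTilde μ).smulRight a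
  have hA : ∀ a b, A a b = a * sndTilde μ b - integralL μ (sndTilde μ b) • a := fun _ _ => rfl
  refine isAmenable_of_invariant (m := NormedSpace.inclusionInDoubleDual ℂ _ e -
    φ ∘L ContinuousLinearMap.precomp ℂ (A e)) ?_ fun F s => ?_
  · have h0 : integralL μ ∘L A e = 0 := by
      ext b
      simp [hA, integralL_mul, he]
    show integralL μ e - φ (integralL μ ∘L A e) = 1
    rw [h0, map_zero, sub_zero, he]
  · show F (leftTranslate s e) - φ ((F ∘L leftTranslateL s) ∘L A e) = F e - φ (F ∘L A e)
    have hd : integralL μ (leftTranslate s e - e) = 0 := by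
      rw [map_sub, integralL_leftTranslate, sub_self]
    -- `λ_s (e b) - e b = d b` with `d = λ_s e - e` of mass zero, so that `φ` acts as a right
    -- identity on `d`.
    have h1 : (F ∘L leftTranslateL s) ∘L A e - F ∘L A e =
        (F ∘L sndTilde μ) ∘L ContinuousLinearMap.mul ℂ (tildeL10 μ)
          (toTilde μ (leftTranslate s e - e)) := by
      ext b
      simp only [sub_apply, ContinuousLinearMap.comp_apply, ContinuousLinearMap.mul_apply',
        sndTilde_mul, sndTilde_toTilde, hd, zero_smul, sub_zero, hA, leftTranslateL_apply]
      rw [← leftTranslateL_apply, map_sub, map_smul, leftTranslateL_apply, leftTranslateL_apply,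
        leftTranslate_mul_eq, ← map_sub]
      congr 1
      rw [sub_mul, smul_sub]
      abel
    have h2 := hφ (F ∘L sndTilde μ) (toTilde μ (leftTranslate s e - e))
    rw [← h1, map_sub, ContinuousLinearMap.comp_apply, sndTilde_toTilde, map_sub] at h2
    linear_combination -h2

end Ideals

end GroupAlgebra

namespace GroupAlgebra

/-! ### Integrated forms of bounded anti-representations. -/

section IntegratedForm

variable {G : Type u} [Group G] [TopologicalSpace G] [IsTopologicalGroup G]
  [LocallyCompactSpace G] [MeasurableSpace G] [BorelSpace G]
  {μ : Measure G} [μ.IsHaarMeasure] [μ.Regular]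

section

variable {E : Type*} [NormedAddCommGroup E] [NormedSpace ℂ E] {π : G → (E →L[ℂ] E)}

theorem norm_apply_le_of_bound {C : ℝ} (hC : ∀ t, ‖π t‖ ≤ C) (x : E) (t : G) :
    ‖π t x‖ ≤ C * ‖x‖ :=
  ((π t).le_opNorm x).trans (mul_le_mul_of_nonneg_right (hC t) (norm_nonneg _))

theorem IsBoundedAntiRep.integrable (hπ : IsBoundedAntiRep π) (a : Lp ℂ 1 μ) (x : E) :
    Integrable (fun t => a t • π t x) μ := by
  obtain ⟨C, hC⟩ := hπ.bounded
  exact integrable_smul a (hπ.continuous_apply x) (norm_apply_le_of_bound hC x)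

variable (μ) in
/-- The integrated form of a bounded anti-representation, as a bounded bilinear map. -/
theorem IsBoundedAntiRep.exists_integratedL (hπ : IsBoundedAntiRep π) :
    ∃ I : Lp ℂ 1 μ →L[ℂ] E →L[ℂ] E, ∀ a x, I a x = integratedForm π a x := by
  obtain ⟨C, hC⟩ := hπ.bounded
  have hI : ∀ a x, integratedForm π a x = integrateAgainst (μ := μ) (hπ.continuous_apply x)
    (norm_apply_le_of_bound hC x) a := fun _ _ => rfl
  refine ⟨LinearMap.mkContinuous₂ (LinearMap.mk₂ ℂ (integratedForm π) ?_ ?_ ?_ ?_) C ?_,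
    fun a x => rfl⟩
  · intro a b x
    rw [hI, hI, hI, map_add]
  · intro c a x
    rw [hI, hI, map_smul]
  · intro a x y
    simp only [integratedForm, map_add, smul_add]
    exact integral_add (hπ.integrable a x) (hπ.integrable a y)
  · intro c a x
    simp only [integratedForm, map_smul, smul_comm _ c]
    exact integral_smul _ _
  · intro a x
    rw [LinearMap.mk₂_apply, L1.norm_eq_integral_norm]
    refine (norm_integral_le_of_norm_le ((L1.integrable_coeFn a).norm.mul_const (C * ‖x‖))
      (ae_of_all _ fun t => ?_)).trans_eq (by rw [integral_mul_const]; ring)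
    rw [norm_smul]
    exact mul_le_mul_of_nonneg_left (norm_apply_le_of_bound hC x t) (norm_nonneg _)

theorem IsBoundedAntiRep.integratedForm_mul [CompleteSpace E] (hπ : IsBoundedAntiRep π)
    (a b : Lp ℂ 1 μ) (x : E) :
    integratedForm π (a * b) x = integratedForm π b (integratedForm π a x) := by
  obtain ⟨C, hC⟩ := hπ.bounded
  obtain ⟨I, hI⟩ := hπ.exists_integratedL μ
  refine (integral_convolve_smul a b (hπ.continuous_apply x)
    (norm_apply_le_of_bound hC x)).trans ?_
  rw [← hI b, integratedForm, ← (I b).integral_comp_comm (hπ.integrable a x)]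
  simp only [map_smul, hπ.map_mul]
  simp only [hI]
  rfl

end

variable (μ) in
/-- Property (CB) of `L¹₀(G)` restricted to the modules that come from bounded
anti-representations of `G`. -/
def HasIntegratedCB : Prop :=
  ∀ (E : Type v) [NormedAddCommGroup E] [NormedSpace ℂ E] [CompleteSpace E]
    (π : G → (E →L[ℂ] E)) (Ξ : L10 μ →L[ℂ] StrongDual ℂ E),
    IsBoundedAntiRep π →
    (∀ (a b : L10 μ) (x : E), Ξ (a * b) x = Ξ b (integratedForm π a.1 x)) →
    ∃ f : StrongDual ℂ E, ∀ (a : L10 μ) (x : E), Ξ a x = f (integratedForm π a.1 x)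

theorem HasPropertyCB.hasIntegratedCB (h : HasPropertyCB.{u, v} (L10 μ)) :
    HasIntegratedCB.{u, v} μ := by
  intro E _ _ _ π Ξ hπ hΞ
  obtain ⟨I, hI⟩ := hπ.exists_integratedL μ
  obtain ⟨f, hf⟩ := h E (I ∘L inclL10 μ) Ξ (fun a b => by
    ext x
    show I (a.1 * b.1) x = I b.1 (I a.1 x)
    simp only [hI, hπ.integratedForm_mul]) fun a b => by
    ext x
    rw [hΞ, ← hI]
    rfl
  refine ⟨f, fun a x => ?_⟩
  rw [hf, ← hI]
  rfl

/-- The space `contDual` used to prove amenability lives in the universe of `G`; the statement is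
brought there by lifting representations. -/
theorem HasIntegratedCB.of_max (h : HasIntegratedCB.{u, max u v} μ) :
    HasIntegratedCB.{u, u} μ := by
  intro E _ _ _ π Ξ hπ hΞ
  let L : ULift.{v} E ≃L[ℂ] E := ContinuousLinearEquiv.ulift
  let π' : G → ULift.{v} E →L[ℂ] ULift.{v} E := fun t =>
    L.symm.toContinuousLinearMap ∘L π t ∘L L.toContinuousLinearMap
  have hint : ∀ (a : Lp ℂ 1 μ) x, L (integratedForm π' a x) = integratedForm π a (L x) :=
    fun a x => by
      rw [integratedForm, ← ContinuousLinearEquiv.integral_comp_comm]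
      rfl
  have hπ' : IsBoundedAntiRep π' := by
    refine ⟨?_, fun s t => ?_, fun x => ?_, ?_⟩
    · simp only [π', hπ.map_one]
      rfl
    · simp only [π', hπ.map_mul]
      rfl
    · exact L.symm.continuous.comp (hπ.continuous_apply (L x))
    · obtain ⟨C, hC⟩ := hπ.bounded
      refine ⟨C, fun t => ContinuousLinearMap.opNorm_le_bound _ ((norm_nonneg _).trans (hC t))
        fun x => norm_apply_le_of_bound hC (L x) t⟩
  obtain ⟨f, hf⟩ := h (ULift.{v} E) π'
    (ContinuousLinearMap.precomp ℂ L.toContinuousLinearMap ∘L Ξ) hπ' fun a b x => by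
      show Ξ (a * b) (L x) = Ξ b (L (integratedForm π' a.1 x))
      rw [hΞ, hint]
  refine ⟨f ∘L L.symm.toContinuousLinearMap, fun a x => ?_⟩
  refine (hf a (L.symm x)).trans (congrArg f ?_)
  rw [← L.symm_apply_apply (integratedForm π' a.1 (L.symm x)), hint, L.apply_symm_apply]
  rfl

end IntegratedForm

/-! ### Functionals with norm-continuous orbits. -/

section ContinuousFunctionals

variable {G : Type*} [Group G] [TopologicalSpace G] {V : Type*} [NormedAddCommGroup V]
  [NormedSpace ℂ V] {T : G → (V →L[ℂ] V)}

theorem norm_comp_le_of_norm_le_one (hT : ∀ t, ‖T t‖ ≤ 1) (F : StrongDual ℂ V) (s : G) :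
    ‖F ∘L T s‖ ≤ ‖F‖ :=
  (F.opNorm_comp_le _).trans (mul_le_of_le_one_right (norm_nonneg _) (hT s))

variable (T) in
/-- The functionals on `V` with a norm-continuous orbit under `T`. -/
def contDual : Submodule ℂ (StrongDual ℂ V) where
  carrier := {F | Continuous fun t : G => F ∘L T t}
  zero_mem' := by
    simp only [Set.mem_ofPred_eq, ContinuousLinearMap.zero_comp]
    exact continuous_const
  add_mem' := fun {F F'} hF hF' => by
    simp only [Set.mem_ofPred_eq, ContinuousLinearMap.add_comp]
    exact Continuous.add hF hF'
  smul_mem' := fun c F hF => by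
    simp only [Set.mem_ofPred_eq, ContinuousLinearMap.smul_comp]
    exact Continuous.const_smul hF c

theorem mem_contDual_iff {F : StrongDual ℂ V} :
    F ∈ contDual T ↔ Continuous fun t : G => F ∘L T t := Iff.rfl

/-- As the operators are contractions, orbit maps of a norm limit are uniform limits of orbit maps.
Closedness makes `contDual T` a Banach space. -/
theorem isClosed_contDual (hT : ∀ t, ‖T t‖ ≤ 1) :
    IsClosed (contDual T : Set (StrongDual ℂ V)) := by
  refine isClosed_of_closure_subset fun F hF => ?_
  refine continuous_of_uniform_approx_of_continuous fun u hu => ?_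
  obtain ⟨ε, hε, hu⟩ := Metric.mem_uniformity_dist.1 hu
  obtain ⟨F', hF', hd⟩ := Metric.mem_closure_iff.1 hF ε hε
  refine ⟨fun t => F' ∘L T t, hF', fun t => hu ?_⟩
  rw [dist_eq_norm] at hd ⊢
  rw [← ContinuousLinearMap.sub_comp]
  exact (norm_comp_le_of_norm_le_one hT _ t).trans_lt hd

variable [IsTopologicalGroup G] (hTm : ∀ s t, T (s * t) = T s ∘L T t)

/-- The action of `G` on `contDual T`. -/
def contDualRep (t : G) : contDual T →L[ℂ] contDual T :=
  (ContinuousLinearMap.precomp ℂ (T t) ∘L (contDual T).subtypeL).codRestrict _ fun F => by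
    rw [mem_contDual_iff]
    refine (F.2.comp (continuous_const_mul t)).congr fun s => ?_
    simp only [Function.comp_apply, hTm]
    rfl

theorem contDualRep_apply (t : G) (F : contDual T) (b : V) :
    (contDualRep hTm t F).1 b = F.1 (T t b) := rfl

theorem isBoundedAntiRep_contDualRep (hT1 : T 1 = ContinuousLinearMap.id ℂ V)
    (hT : ∀ t, ‖T t‖ ≤ 1) : IsBoundedAntiRep (E := contDual T) (contDualRep hTm) := by
  refine ⟨?_, fun s t => ?_, fun F => F.2.subtype_mk _, 1, fun t => ?_⟩
  · refine ContinuousLinearMap.ext fun F => Subtype.ext (ContinuousLinearMap.ext fun b => ?_)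
    rw [contDualRep_apply, hT1]
    rfl
  · refine ContinuousLinearMap.ext fun F => Subtype.ext (ContinuousLinearMap.ext fun b => ?_)
    rw [contDualRep_apply, hTm]
    rfl
  · refine ContinuousLinearMap.opNorm_le_bound _ zero_le_one fun F => ?_
    rw [one_mul]
    exact norm_comp_le_of_norm_le_one hT F.1 t

theorem integratedForm_contDualRep_apply [LocallyCompactSpace G] [MeasurableSpace G]
    [BorelSpace G] {μ : Measure G} [μ.IsHaarMeasure] [μ.Regular]
    (hT1 : T 1 = ContinuousLinearMap.id ℂ V) (hT : ∀ t, ‖T t‖ ≤ 1) (f : Lp ℂ 1 μ)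
    (F : contDual T) (b : V) :
    (integratedForm (E := contDual T) (contDualRep hTm) f F).1 b = ∫ t, f t • F.1 (T t b) ∂μ := by
  have : CompleteSpace (contDual T) := (isClosed_contDual hT).completeSpace_coe
  let ev : contDual T →L[ℂ] ℂ :=
    NormedSpace.inclusionInDoubleDual ℂ V b ∘L (contDual T).subtypeL
  have h1 := ContinuousLinearMap.integral_comp_comm (𝕜 := ℂ) (E := contDual T) (Fₗ := ℂ) ev
    ((isBoundedAntiRep_contDualRep hTm hT1 hT).integrable f F)
  refine h1.symm.trans ?_
  simp only [map_smul]
  rfl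

end ContinuousFunctionals

end GroupAlgebra

namespace GroupAlgebra

/-! ### Amenability from the module of functionals with continuous orbits. -/

section AugmentationIdeal

variable {G : Type*} [Group G] [TopologicalSpace G] [IsTopologicalGroup G]
  [LocallyCompactSpace G] [MeasurableSpace G] [BorelSpace G]
  {μ : Measure G} [μ.IsHaarMeasure] [μ.Regular]
  {V : Type*} [NormedAddCommGroup V] [NormedSpace ℂ V]

/-- `ι` identifies `V` with the kernel of integration on `L¹(G)`, with `P` as a projection. -/
structure IsAugmentationIdeal (ι : V →L[ℂ] Lp ℂ 1 μ) (P : Lp ℂ 1 μ →L[ℂ] V) : Prop where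
  norm_le : ∀ v, ‖v‖ ≤ ‖ι v‖
  norm_ge : ∀ v, ‖ι v‖ ≤ ‖v‖
  proj_apply : ∀ v, P (ι v) = v
  integral_eq_zero : ∀ v, integralL μ (ι v) = 0
  apply_proj : ∀ f, integralL μ f = 0 → ι (P f) = f

/-- Left translation on the augmentation ideal. -/
def translateIdeal (ι : V →L[ℂ] Lp ℂ 1 μ) (P : Lp ℂ 1 μ →L[ℂ] V) (s : G) : V →L[ℂ] V :=
  P ∘L leftTranslateL s ∘L ι

/-- The left action of `L¹(G)` on the augmentation ideal. -/
def actIdeal (ι : V →L[ℂ] Lp ℂ 1 μ) (P : Lp ℂ 1 μ →L[ℂ] V) : Lp ℂ 1 μ →L[ℂ] V →L[ℂ] V :=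
  ContinuousLinearMap.compL ℂ V (Lp ℂ 1 μ) V P ∘L
    ContinuousLinearMap.precomp (Lp ℂ 1 μ) ι ∘L ContinuousLinearMap.mul ℂ (Lp ℂ 1 μ)

namespace IsAugmentationIdeal

variable {ι : V →L[ℂ] Lp ℂ 1 μ} {P : Lp ℂ 1 μ →L[ℂ] V}

theorem coe_translateIdeal (h : IsAugmentationIdeal ι P) (s : G) (v : V) :
    ι (translateIdeal ι P s v) = leftTranslate s (ι v) :=
  h.apply_proj _ ((integralL_leftTranslate s _).trans (h.integral_eq_zero v))

theorem coe_actIdeal (h : IsAugmentationIdeal ι P) (f : Lp ℂ 1 μ) (v : V) :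
    ι (actIdeal ι P f v) = f * ι v :=
  h.apply_proj (f * ι v) (by rw [integralL_mul, h.integral_eq_zero, mul_zero])

theorem ext (h : IsAugmentationIdeal ι P) {v w : V} (hvw : ι v = ι w) : v = w := by
  rw [← h.proj_apply v, hvw, h.proj_apply]

theorem actIdeal_mul (h : IsAugmentationIdeal ι P) (f g : Lp ℂ 1 μ) :
    actIdeal ι P (f * g) = actIdeal ι P f ∘L actIdeal ι P g := by
  refine ContinuousLinearMap.ext fun v => h.ext ?_
  simp only [ContinuousLinearMap.comp_apply, h.coe_actIdeal, mul_assoc]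

theorem translateIdeal_mul (h : IsAugmentationIdeal ι P) (s t : G) :
    translateIdeal ι P (s * t) = translateIdeal ι P s ∘L translateIdeal ι P t := by
  refine ContinuousLinearMap.ext fun v => h.ext ?_
  simp only [ContinuousLinearMap.comp_apply, h.coe_translateIdeal, leftTranslate_mul]

theorem translateIdeal_one (h : IsAugmentationIdeal ι P) :
    translateIdeal ι P (1 : G) = ContinuousLinearMap.id ℂ V := by
  refine ContinuousLinearMap.ext fun v => h.ext ?_
  rw [h.coe_translateIdeal, leftTranslate_one]
  rfl

theorem norm_translateIdeal_le (h : IsAugmentationIdeal ι P) (s : G) :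
    ‖translateIdeal ι P s‖ ≤ 1 :=
  ContinuousLinearMap.opNorm_le_bound _ zero_le_one fun v => by
    refine (h.norm_le _).trans ?_
    rw [h.coe_translateIdeal, norm_leftTranslate, one_mul]
    exact h.norm_ge v

/-- Translating `F(f ·)` by `t` gives `F((f * δ_t) ·)`, and `t ↦ f * δ_t` is norm-continuous for `f`
in `C_c(G)`; the rest is density and closedness. -/
theorem comp_actIdeal_mem_contDual (h : IsAugmentationIdeal ι P) (F : StrongDual ℂ V)
    (f : Lp ℂ 1 μ) :
    F ∘L actIdeal ι P f ∈ contDual (translateIdeal ι P) := by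
  have hc : Continuous fun f => F ∘L actIdeal ι P f :=
    (ContinuousLinearMap.compL ℂ V V ℂ F ∘L actIdeal ι P).continuous
  refine (denseRange_ccToL1 μ).induction_on f
    ((isClosed_contDual h.norm_translateIdeal_le).preimage hc) fun k => ?_
  refine (hc.comp (continuous_ccRight μ k)).congr fun t => ?_
  refine ContinuousLinearMap.ext fun v => congrArg F (h.ext ?_)
  refine (h.coe_actIdeal _ v).trans (Eq.trans ?_ (h.coe_actIdeal _ _).symm)
  exact (ccRight_mul k t (ι v)).trans
    (congrArg (ccToL1 μ k * ·) (h.coe_translateIdeal t v).symm)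

theorem integratedForm_contDualRep (h : IsAugmentationIdeal ι P) (f : Lp ℂ 1 μ)
    (F : contDual (translateIdeal ι P)) :
    integratedForm (E := contDual (translateIdeal ι P)) (contDualRep h.translateIdeal_mul) f F =
      ⟨F.1 ∘L actIdeal ι P f, h.comp_actIdeal_mem_contDual F.1 f⟩ := by
  refine Subtype.ext (ContinuousLinearMap.ext fun v => ?_)
  rw [integratedForm_contDualRep_apply _ h.translateIdeal_one h.norm_translateIdeal_le]
  have h2 := (F.1 ∘L P).integral_comp_comm (integrable_smul f
    (continuous_leftTranslate (ι v)) (fun s => (norm_leftTranslate s _).le))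
  refine Eq.trans ?_ h2
  simp only [map_smul]
  rfl

/-- The identity extends from functionals with continuous orbits to all `F`: apply it to `F(e_W ·)`,
which gives `φ(F((e_W * v) ·)) = F(e_W * v)`, and let `e_W * v` tend to `v`. -/
theorem apply_comp_actIdeal (h : IsAugmentationIdeal ι P)
    {φ : StrongDual ℂ (contDual (translateIdeal ι P))}
    (hφ : ∀ (v : V) (F : contDual (translateIdeal ι P)),
      F.1 v = φ (integratedForm (E := contDual (translateIdeal ι P))
        (contDualRep h.translateIdeal_mul) (ι v) F))
    (F : StrongDual ℂ V) (v : V) :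
    φ ⟨F ∘L actIdeal ι P (ι v), h.comp_actIdeal_mem_contDual F (ι v)⟩ = F v := by
  obtain ⟨l, e, hl, -, -, hleft, -⟩ := exists_approximate_identity μ
  have hc : Continuous fun g : Lp ℂ 1 μ =>
      φ ⟨F ∘L actIdeal ι P g, h.comp_actIdeal_mem_contDual F g⟩ :=
    φ.continuous.comp (Continuous.subtype_mk
      (ContinuousLinearMap.compL ℂ V V ℂ F ∘L actIdeal ι P).continuous _)
  have h1 := (hc.tendsto _).comp (hleft (ι v))
  have h2 := ((F ∘L P).continuous.tendsto _).comp (hleft (ι v))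
  rw [ContinuousLinearMap.comp_apply, h.proj_apply] at h2
  refine tendsto_nhds_unique h1 (h2.congr fun W => ?_)
  have h3 := hφ v ⟨F ∘L actIdeal ι P (ccToL1 μ (e W)), h.comp_actIdeal_mem_contDual F _⟩
  rw [h.integratedForm_contDualRep] at h3
  simp only [Function.comp_apply, h.actIdeal_mul]
  exact h3

/-- Again `m = e - e φ`. Although `φ` is defined only on `contDual`, `e φ` makes sense on all
functionals because each `F(e ·)` has a continuous orbit. -/
theorem isAmenable (h : IsAugmentationIdeal ι P)
    {φ : StrongDual ℂ (contDual (translateIdeal ι P))}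
    (hφ : ∀ (v : V) (F : contDual (translateIdeal ι P)),
      F.1 v = φ (integratedForm (E := contDual (translateIdeal ι P))
        (contDualRep h.translateIdeal_mul) (ι v) F)) : IsAmenable μ := by
  obtain ⟨e', -, he', -⟩ := exists_cc_integral_eq_one μ (univ_mem (f := 𝓝 (1 : G)))
  set e := ccToL1 μ e' with he_def
  have he : integralL μ e = 1 := by rw [integralL_apply, integral_ccToL1, he']
  let J : StrongDual ℂ V →L[ℂ] contDual (translateIdeal ι P) :=
    (ContinuousLinearMap.precomp ℂ (actIdeal ι P e)).codRestrict _ fun F =>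
      h.comp_actIdeal_mem_contDual F e
  refine isAmenable_of_invariant (m := NormedSpace.inclusionInDoubleDual ℂ _ e -
    φ ∘L J ∘L ContinuousLinearMap.precomp ℂ ι) ?_ fun F s => ?_
  · have h0 : integralL μ ∘L ι = 0 := ContinuousLinearMap.ext h.integral_eq_zero
    show integralL μ e - φ (J (integralL μ ∘L ι)) = 1
    rw [h0, map_zero, map_zero, sub_zero, he]
  · show F (leftTranslate s e) - φ (J ((F ∘L leftTranslateL s) ∘L ι)) = F e - φ (J (F ∘L ι))
    set d := leftTranslate s e - e with hd_def
    have hd : ι (P d) = d := h.apply_proj _ (by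
      rw [hd_def, map_sub, integralL_leftTranslate, sub_self])
    have h1 := h.apply_comp_actIdeal hφ (F ∘L ι) (P d)
    have h2 : J ((F ∘L leftTranslateL s) ∘L ι - F ∘L ι) =
        ⟨(F ∘L ι) ∘L actIdeal ι P (ι (P d)), h.comp_actIdeal_mem_contDual _ _⟩ := by
      refine Subtype.ext (ContinuousLinearMap.ext fun v => ?_)
      show F (leftTranslate s (ι (actIdeal ι P e v))) - F (ι (actIdeal ι P e v)) =
        F (ι (actIdeal ι P (ι (P d)) v))
      rw [← map_sub, h.coe_actIdeal, h.coe_actIdeal, leftTranslate_mul_eq, hd, hd_def, sub_mul]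
    have h3 : (F ∘L ι) (P d) = F (leftTranslate s e) - F e := by
      rw [ContinuousLinearMap.comp_apply, hd, hd_def, map_sub]
    rw [← h2, h3] at h1
    have h4 := h1.symm.trans ((φ ∘L J).map_sub ((F ∘L leftTranslateL s) ∘L ι) (F ∘L ι))
    simp only [ContinuousLinearMap.comp_apply] at h4
    linear_combination h4

theorem isAmenable_of_forall_rep {W : Type u} [NormedAddCommGroup W] [NormedSpace ℂ W]
    {ι : W →L[ℂ] Lp ℂ 1 μ} {P : Lp ℂ 1 μ →L[ℂ] W} (h : IsAugmentationIdeal ι P)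
    (H : ∀ (E : Type u) [NormedAddCommGroup E] [NormedSpace ℂ E] [CompleteSpace E]
      (π : G → (E →L[ℂ] E)) (Ξ : W →L[ℂ] StrongDual ℂ E), IsBoundedAntiRep π →
      (∀ v w x, Ξ (actIdeal ι P (ι v) w) x = Ξ w (integratedForm π (ι v) x)) →
      ∃ f : StrongDual ℂ E, ∀ v x, Ξ v x = f (integratedForm π (ι v) x)) : IsAmenable μ := by
  have : CompleteSpace (contDual (translateIdeal ι P)) :=
    (isClosed_contDual h.norm_translateIdeal_le).completeSpace_coe
  -- The module map is evaluation, `v ↦ (F ↦ F v)`.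
  obtain ⟨φ, hφ⟩ := H (contDual (translateIdeal ι P)) (contDualRep h.translateIdeal_mul)
    (ContinuousLinearMap.precomp ℂ (contDual (translateIdeal ι P)).subtypeL ∘L
      NormedSpace.inclusionInDoubleDual ℂ W)
    (isBoundedAntiRep_contDualRep h.translateIdeal_mul h.translateIdeal_one
      h.norm_translateIdeal_le)
    fun v w F => by
      rw [h.integratedForm_contDualRep]
      rfl
  exact h.isAmenable (φ := φ) hφ

end IsAugmentationIdeal

end AugmentationIdeal

section

variable {G : Type u} [Group G] [TopologicalSpace G] [IsTopologicalGroup G]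
  [LocallyCompactSpace G] [MeasurableSpace G] [BorelSpace G]
  {μ : Measure G} [μ.IsHaarMeasure] [μ.Regular]

theorem isAugmentationIdeal_L10 (e : Lp ℂ 1 μ) (he : integralL μ e = 1) :
    IsAugmentationIdeal (inclL10 μ) (projL10 e he) where
  norm_le _ := le_rfl
  norm_ge _ := le_rfl
  proj_apply a := Subtype.ext (by
    rw [coe_projL10, inclL10_apply, mem_L10_iff.1 a.2, zero_smul, sub_zero])
  integral_eq_zero a := mem_L10_iff.1 a.2
  apply_proj f hf := by rw [inclL10_apply, coe_projL10, hf, zero_smul, sub_zero]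

theorem HasIntegratedCB.isAmenable (hCB : HasIntegratedCB.{u, u} μ) : IsAmenable μ := by
  obtain ⟨e, -, he, -⟩ := exists_cc_integral_eq_one μ (univ_mem (f := 𝓝 (1 : G)))
  have h := isAugmentationIdeal_L10 (ccToL1 μ e) (by rw [integralL_apply, integral_ccToL1, he])
  refine h.isAmenable_of_forall_rep fun E _ _ _ π Ξ hπ hΞ => hCB E π Ξ hπ fun a b x => ?_
  rw [← inclL10_apply, ← hΞ]
  exact congrArg (fun c => Ξ c x) (h.ext (h.coe_actIdeal _ _).symm)

end

end GroupAlgebra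

end

open GroupAlgebra in
theorem mainTheorem6 (G : Type u) [Group G] [TopologicalSpace G] [IsTopologicalGroup G]
    [T2Space G] [LocallyCompactSpace G] [MeasurableSpace G] [BorelSpace G]
    (μ : MeasureTheory.Measure G) [μ.IsHaarMeasure] [μ.Regular] :
    List.TFAE [
      IsAmenable μ,
      HasPropertyCB.{u, max u v} (tildeL10 μ),
      HasPropertyCB.{u, max u v} (L10 μ),
      ∀ (E : Type (max u v)) [NormedAddCommGroup E] [NormedSpace ℂ E] [CompleteSpace E]
        (π : G → (E →L[ℂ] E)) (Ξ : L10 μ →L[ℂ] StrongDual ℂ E),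
        IsBoundedAntiRep π →
        (∀ (a b : L10 μ) (x : E), Ξ (a * b) x = Ξ b (integratedForm π a.1 x)) →
        ∃ f : StrongDual ℂ E, ∀ (a : L10 μ) (x : E), Ξ a x = f (integratedForm π a.1 x)] := by
  tfae_have 1 → 2 := fun h => h.hasVirtualRightIdentity_tildeL10.hasPropertyCB
  tfae_have 2 → 1 := fun h =>
    isAmenable_of_hasVirtualRightIdentity_tildeL10 (h.hasVirtualRightIdentity)
  tfae_have 1 → 3 := fun h => h.hasVirtualRightIdentity_L10.hasPropertyCB
  tfae_have 3 → 4 := fun h => h.hasIntegratedCB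
  tfae_have 4 → 1 := fun h => (HasIntegratedCB.of_max.{u, v} h).isAmenable
  tfae_finish
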